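/- \textbf{Setting.} All objects are $C^\infty$. Let $(M,g)$ be a four-dimensional pseudo-Riemannian manifold, $X$ a vector field and $\Lambda\in\mathbb R$ with $\mathrm{Ric}(g)+\tfrac12L_Xg=\Lambda g$ (a Ricci soliton). Let $\mathcal G_2$ be a two-dimensional Abelian Lie algebra of Killing fields of $g$, spanning a rank-two distribution $\Xi$. Coordinates $(t_1,t_2,z_1,z_2)$ are \emph{adapted} if $\partial_{z_1},\partial_{z_2}$ generate $\mathcal G_2$. In adapted coordinates $$g=b_{ij}\,dt_idt_j+2f_{ik}\,dt_idz_k+h_{kl}\,dz_kdz_l,\qquad f_j^k=f_{js}h^{sk},\qquad \tilde g_{ij}=b_{ij}-f_{ik}f_{jl}h^{kl},$$ with coefficients depending on $(t_1,t_2)$ only; $\tilde g$ is the orbit metric, and $\mathcal C=\sum_k|\det\tilde g|^{-1/2}\,(\partial_{t_2}f_1^k-\partial_{t_1}f_2^k)\,\partial_{z_k}$ is the curvature vector field. Assume that the leaves of $\Xi$ are non-null ($\det(h_{kl})\ne0$) and orthogonally intransitive ($\mathcal C\neq0$ everywhere), and that (i) $g(\mathcal C,\mathcal C)=0$; (ii)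 some nonzero element of $\mathcal G_2$ is null everywhere; (iii) $X$ is tangent to $\Xi$ and is a symmetry of $\Xi^\perp$, i.e. $[X,Y]$ is a section of $\Xi^\perp$ for every local section $Y$ of $\Xi^\perp$. Adapted coordinates are called \emph{normal} if $h_{22}=0$, $f_2^1=f_2^2=0$ and $\tilde g=e^{-2P}(dt_1^2+\epsilon_0dt_2^2)$ with $\epsilon_0=\pm1$; that is, $$g=e^{-2P}(dt_1^2+\epsilon_0dt_2^2)+h_{11}(dz_1+f_1^1dt_1)^2+2h_{12}(dz_1+f_1^1dt_1)(dz_2+f_1^2dt_1).$$ The soliton is in \emph{Case II-3} at $p\in M$ if there are normal coordinates around $p$ with $f^1_{1,t_2}=0$, and $h_{12,t_1}=0$ in all normal coordinates around $p$ with $f^1_{1,t_2}=0$. \textbf{Theorem.} (a) If the soliton is in Case II-3 at $p$, then there are adapted coordinates $(t_1,t_2,z_1,z_2)$ around $p$ in which $$g=e^{-2P}(dt_1^2+\epsilon_0dt_2^2)+2c\Big(\int e^{-2P}dt_2\Big)dt_1dz_1+\psi\,dz_1^2+2\,dz_1dz_2,\qquad X=(2\Lambda z_1+a)\partial_{z_1}+A\,\partial_{z_2},$$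 where $\epsilon_0=\pm1$, $a,c\in\mathbb R$, $c\ne0$, $\int e^{-2P}dt_2$ is a function of $(t_1,t_2)$ whose $t_2$-derivative is $e^{-2P}$, and $A=A(z_1)$, $P=P(t_1,t_2)$, $\psi=\psi(t_1,t_2)$ satisfy $$\psi_{,t_1t_1}+\epsilon_0\psi_{,t_2t_2}-2\Lambda e^{-2P}\psi=\epsilon_0e^{-2P}\big(c^2+2\epsilon_0A'\big),\qquad P_{,t_1t_1}+\epsilon_0P_{,t_2t_2}=\Lambda e^{-2P}.$$ In these coordinates the orbit metric is $\tilde g=e^{-2P}(dt_1^2+\epsilon_0dt_2^2)$, and it has constant Gauss curvature $\Lambda$. (b) Conversely, on any open set of $\mathbb R^4$, for all $\epsilon_0=\pm1$, all $\Lambda,a,c\in\mathbb R$ with $c\neq0$, and all $A,P,\psi$, $\int e^{-2P}dt_2$ as in (a), the formulas above define a pseudo-Riemannian metric $g$ and a field $X$ with $\mathrm{Ric}(g)+\tfrac12L_Xg=\Lambda g$, for which $\partial_{z_1},\partial_{z_2}$ are Killing fields, the leaves are non-null and orthogonally intransitive, (i)--(iii) hold ($\partial_{z_2}$ is null), and the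 coordinates are normal with $f^1_{1,t_2}=0$ and $h_{12}$ constant. (c) For every $\Lambda\in\mathbb R$ and every $\epsilon_0=\pm1$ such data exist on some non-empty open set; so the soliton can be expanding ($\Lambda<0$), steady ($\Lambda=0$) or shrinking ($\Lambda>0$). -/

import Mathlib

open scoped Manifold ContDiff

noncomputable section

namespace RicciSoliton

/-! ### Tensor calculus in coordinates on open subsets of `ℝⁿ` -/

/-- Coordinate space `ℝⁿ`. -/
abbrev Crd (n : ℕ) : Type := EuclideanSpace ℝ (Fin n)

/-- The `i`-th coordinate vector. -/
def basisVec {n : ℕ} (i : Fin n) : Crd n := EuclideanSpace.single i 1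

/-- The partial derivative `∂F/∂xⁱ` at `x`. -/
def pd {n : ℕ} (i : Fin n) (F : Crd n → ℝ) (x : Crd n) : ℝ :=
  fderiv ℝ F x (basisVec i)

/-- The Christoffel symbol `Γᵏᵢⱼ` of the metric with component matrix `G`. -/
def christoffel {n : ℕ} (G : Crd n → Matrix (Fin n) (Fin n) ℝ) (k i j : Fin n) (x : Crd n) : ℝ :=
  (1 / 2) * ∑ l, (G x)⁻¹ k l *
    (pd i (fun y => G y j l) x + pd j (fun y => G y i l) x - pd l (fun y => G y i j) x)

/-- The component `Rˡₖᵢⱼ` of the curvature tensor: `R(∂ᵢ, ∂ⱼ)∂ₖ = ∑ l, Rˡₖᵢⱼ ∂ₗ`, where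
`R(X, Y) = ∇_X ∇_Y - ∇_Y ∇_X - ∇_[X,Y]`. -/
def riemann {n : ℕ} (G : Crd n → Matrix (Fin n) (Fin n) ℝ) (l k i j : Fin n) (x : Crd n) : ℝ :=
  pd i (christoffel G l j k) x - pd j (christoffel G l i k) x
    + ∑ m, (christoffel G l i m x * christoffel G m j k x
      - christoffel G l j m x * christoffel G m i k x)

/-- The Ricci tensor `Ricₖⱼ = ∑ i, Rⁱₖᵢⱼ`. -/
def ricci {n : ℕ} (G : Crd n → Matrix (Fin n) (Fin n) ℝ) (k j : Fin n) (x : Crd n) : ℝ :=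
  ∑ i, riemann G i k i j x

/-- The Gauss curvature `g(R(∂₁, ∂₂)∂₂, ∂₁) / det g` of a two-dimensional metric. -/
def gaussCurvature (q : Crd 2 → Matrix (Fin 2) (Fin 2) ℝ) (t : Crd 2) : ℝ :=
  (∑ l, q t 0 l * riemann q l 1 0 1 t) / (q t).det

/-- The components `(L_V g)ᵢⱼ` of the Lie derivative of the metric `G` along `V`. -/
def lieMetric {n : ℕ} (G : Crd n → Matrix (Fin n) (Fin n) ℝ) (V : Crd n → Crd n)
    (i j : Fin n) (x : Crd n) : ℝ :=
  ∑ k, (V x k * pd k (fun y => G y i j) x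
    + G x k j * pd i (fun y => V y k) x + G x i k * pd j (fun y => V y k) x)

/-- `V` is a Killing field of `G` on `W`. -/
def IsKillingOn {n : ℕ} (W : Set (Crd n)) (G : Crd n → Matrix (Fin n) (Fin n) ℝ)
    (V : Crd n → Crd n) : Prop :=
  ∀ x ∈ W, ∀ i j, lieMetric G V i j x = 0

/-- The Ricci soliton equation `Ric(g) + (1/2) L_V g = Λ g` on `W`. -/
def SolitonEquationOn {n : ℕ} (W : Set (Crd n)) (G : Crd n → Matrix (Fin n) (Fin n) ℝ)
    (V : Crd n → Crd n) (Λ : ℝ) : Prop :=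
  ∀ x ∈ W, ∀ i j, ricci G i j x + (1 / 2) * lieMetric G V i j x = Λ * G x i j

/-! ### Adapted coordinates `(t₁, t₂, z₁, z₂)`

The coordinates `t₁, t₂, z₁, z₂` of a point `x` are `x 0, x 1, x 2, x 3`.  The metric is
`b_{ij} dtᵢ dtⱼ + 2 f_{ik} dtᵢ dz_k + h_{kl} dz_k dz_l`. -/

/-- The projection `(t₁, t₂, z₁, z₂) ↦ (t₁, t₂)`. -/
def tPart (x : Crd 4) : Crd 2 := !₂[x 0, x 1]

/-- The matrix `(b_{ij})`. -/
def bMat (G : Crd 4 → Matrix (Fin 4) (Fin 4) ℝ) (x : Crd 4) : Matrix (Fin 2) (Fin 2) ℝ :=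
  !![G x 0 0, G x 0 1; G x 1 0, G x 1 1]

/-- The matrix `(f_{ik})` with both indices down. -/
def fMat (G : Crd 4 → Matrix (Fin 4) (Fin 4) ℝ) (x : Crd 4) : Matrix (Fin 2) (Fin 2) ℝ :=
  !![G x 0 2, G x 0 3; G x 1 2, G x 1 3]

/-- The matrix `(h_{kl})`, the metric of the Killing leaves. -/
def hMat (G : Crd 4 → Matrix (Fin 4) (Fin 4) ℝ) (x : Crd 4) : Matrix (Fin 2) (Fin 2) ℝ :=
  !![G x 2 2, G x 2 3; G x 3 2, G x 3 3]

/-- The coefficients `fⱼᵏ = ∑ s, f_{js} h^{sk}` (row `j`, column `k`). -/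
def fUp (G : Crd 4 → Matrix (Fin 4) (Fin 4) ℝ) (x : Crd 4) : Matrix (Fin 2) (Fin 2) ℝ :=
  fMat G x * (hMat G x)⁻¹

/-- The orbit metric `g̃ᵢⱼ = b_{ij} - f_{ik} f_{jl} h^{kl}`. -/
def orbitMetric (G : Crd 4 → Matrix (Fin 4) (Fin 4) ℝ) (x : Crd 4) : Matrix (Fin 2) (Fin 2) ℝ :=
  bMat G x - fMat G x * (hMat G x)⁻¹ * (fMat G x).transpose

/-- The components `𝒞ᵏ = (∂_{t₂} f₁ᵏ - ∂_{t₁} f₂ᵏ) / √|det g̃|` of the curvature vector field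
`𝒞 = 𝒞¹ ∂_{z₁} + 𝒞² ∂_{z₂}`. -/
def curvatureField (G : Crd 4 → Matrix (Fin 4) (Fin 4) ℝ) (x : Crd 4) (k : Fin 2) : ℝ :=
  (pd 1 (fun y => fUp G y 0 k) x - pd 0 (fun y => fUp G y 1 k) x)
    / Real.sqrt |(orbitMetric G x).det|

/-- At `x` the vector `v` is orthogonal to the Killing leaf, i.e. to `∂_{z₁}` and `∂_{z₂}`. -/
def IsOrthToLeaf (G : Crd 4 → Matrix (Fin 4) (Fin 4) ℝ) (x v : Crd 4) : Prop :=
  (∑ i, G x i 2 * v i = 0) ∧ (∑ i, G x i 3 * v i = 0)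

/-- The conditions on the pair (metric, soliton field), expressed in adapted coordinates on `W`;
here `Ξ = span {∂_{z₁}, ∂_{z₂}}`. -/
structure AdaptedConditions (W : Set (Crd 4)) (G : Crd 4 → Matrix (Fin 4) (Fin 4) ℝ)
    (V : Crd 4 → Crd 4) : Prop where
  /-- the Killing leaves are non-null -/
  leaves_nonnull : ∀ x ∈ W, (hMat G x).det ≠ 0
  /-- orthogonal intransitivity: `𝒞 ≠ 0` -/
  intransitive : ∀ x ∈ W, curvatureField G x ≠ 0
  /-- `𝒞` is null: `g(𝒞, 𝒞) = 0` -/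
  curvature_null : ∀ x ∈ W,
    ∑ k, ∑ l, hMat G x k l * curvatureField G x k * curvatureField G x l = 0
  /-- `V` is tangent to the Killing leaves -/
  tangent : ∀ x ∈ W, V x 0 = 0 ∧ V x 1 = 0
  /-- `V` is a symmetry of `Ξ^⊥`: `[V, Y]` is a section of `Ξ^⊥` for every local section `Y` -/
  symmetry : ∀ O : Set (Crd 4), IsOpen O → O ⊆ W → ∀ Y : Crd 4 → Crd 4, ContDiffOn ℝ ∞ Y O →
    (∀ x ∈ O, IsOrthToLeaf G x (Y x)) →
      ∀ x ∈ O, IsOrthToLeaf G x (VectorField.lieBracket ℝ V Y x)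

/-- In the adapted coordinates on `W`, `∂_{z₂}` is null, `(g̃ᵢⱼ) = diag (e^{-2P}, ε e^{-2P})` with
`ε = ±1`, and `f₂¹ = f₂² = 0`. -/
structure IsNormalForm (W : Set (Crd 4)) (G : Crd 4 → Matrix (Fin 4) (Fin 4) ℝ) (ε : ℝ) :
    Prop where
  sign : ε = 1 ∨ ε = -1
  null : ∀ x ∈ W, G x 3 3 = 0
  orbit : ∃ P : Crd 4 → ℝ, ∀ x ∈ W,
    orbitMetric G x = !![Real.exp (-2 * P x), 0; 0, ε * Real.exp (-2 * P x)]
  gauge : ∀ x ∈ W, fUp G x 1 0 = 0 ∧ fUp G x 1 1 = 0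

/-! ### Four-dimensional manifolds -/

section Manifold

variable {M : Type*} [TopologicalSpace M] [ChartedSpace (Crd 4) M] [IsManifold (𝓡 4) ∞ M]

/-- The components of a field `g` of bilinear forms in the chart `e`. -/
def chartMetric (e : OpenPartialHomeomorph M (Crd 4))
    (g : ∀ p : M, LinearMap.BilinForm ℝ (TangentSpace (𝓡 4) p)) (x : Crd 4) :
    Matrix (Fin 4) (Fin 4) ℝ :=
  Matrix.of fun i j => g (e.symm x)
    (mfderiv (𝓡 4) (𝓡 4) e.symm x (basisVec i : Crd 4))
    (mfderiv (𝓡 4) (𝓡 4) e.symm x (basisVec j : Crd 4))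

/-- The components of a vector field in the chart `e`. -/
def chartField (e : OpenPartialHomeomorph M (Crd 4))
    (X : ∀ p : M, TangentSpace (𝓡 4) p) : Crd 4 → Crd 4 :=
  VectorField.mpullback (𝓡 4) (𝓡 4) e.symm X

/-- The chart `e` belongs to the smooth structure and is adapted to the algebra `𝒢` of vector
fields: `∂_{z₁}` and `∂_{z₂}` belong to (hence, `𝒢` being two-dimensional, generate) `𝒢`. -/
structure IsAdaptedChart (𝒢 : Submodule ℝ (∀ p : M, TangentSpace (𝓡 4) p))
    (e : OpenPartialHomeomorph M (Crd 4)) : Prop where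
  smooth : e ∈ IsManifold.maximalAtlas (𝓡 4) ∞ M
  dz₁ : ∃ ξ ∈ 𝒢, ∀ x ∈ e.target, chartField e ξ x = basisVec 2
  dz₂ : ∃ ξ ∈ 𝒢, ∀ x ∈ e.target, chartField e ξ x = basisVec 3

/-- `(M, g, X, Λ)` is a Ricci soliton, `g` pseudo-Riemannian, and `𝒢` is a two-dimensional Abelian
algebra of Killing fields, whose leaves are non-null surfaces and orthogonally intransitive, such
that the curvature field is null, `𝒢` has a null vector, and `X` is tangent to the leaves and a
symmetry of the orthogonal distribution. Components and equations are those in every chart of the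
smooth structure. -/
structure StandingHypotheses (g : ∀ p : M, LinearMap.BilinForm ℝ (TangentSpace (𝓡 4) p))
    (𝒢 : Submodule ℝ (∀ p : M, TangentSpace (𝓡 4) p))
    (X : ∀ p : M, TangentSpace (𝓡 4) p) (Λ : ℝ) : Prop where
  metric_symm : ∀ p, (g p).IsSymm
  metric_nondegenerate : ∀ p, (g p).Nondegenerate
  metric_smooth : ∀ e ∈ IsManifold.maximalAtlas (𝓡 4) ∞ M, ∀ i j,
    ContDiffOn ℝ ∞ (fun x => chartMetric e g x i j) e.target
  field_smooth : ContMDiff (𝓡 4) (𝓡 4).tangent ∞ (fun p => (X p : TangentBundle (𝓡 4) M))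
  soliton : ∀ e ∈ IsManifold.maximalAtlas (𝓡 4) ∞ M,
    SolitonEquationOn e.target (chartMetric e g) (chartField e X) Λ
  finrank_eq : Module.finrank ℝ 𝒢 = 2
  killing_smooth : ∀ ξ ∈ 𝒢,
    ContMDiff (𝓡 4) (𝓡 4).tangent ∞ (fun p => (ξ p : TangentBundle (𝓡 4) M))
  killing : ∀ ξ ∈ 𝒢, ∀ e ∈ IsManifold.maximalAtlas (𝓡 4) ∞ M,
    IsKillingOn e.target (chartMetric e g) (chartField e ξ)
  abelian : ∀ ξ ∈ 𝒢, ∀ η ∈ 𝒢, ∀ p, VectorField.mlieBracket (𝓡 4) ξ η p = 0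
  leaves_two_dim : ∀ ξ ∈ 𝒢, ∀ p, ξ p = 0 → ξ = 0
  null_vector : ∃ ξ ∈ 𝒢, ξ ≠ 0 ∧ ∀ p, g p (ξ p) (ξ p) = 0
  adapted : ∀ e, IsAdaptedChart 𝒢 e →
    AdaptedConditions e.target (chartMetric e g) (chartField e X)

/-- `e` is an adapted chart around `p` in which `g` has the normal form
`e^{-2P}(dt₁² + ε dt₂²) + h₁₁(dz₁ + f₁¹dt₁)² + 2h₁₂(dz₁ + f₁¹dt₁)(dz₂ + f₁²dt₁)`, `ε = ±1`,
and in which moreover `f₁¹` does not depend on `t₂`. -/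
structure IsCaseIIChart (g : ∀ p : M, LinearMap.BilinForm ℝ (TangentSpace (𝓡 4) p))
    (𝒢 : Submodule ℝ (∀ p : M, TangentSpace (𝓡 4) p)) (p : M)
    (e : OpenPartialHomeomorph M (Crd 4)) : Prop where
  adapted : IsAdaptedChart 𝒢 e
  mem_source : p ∈ e.source
  normal_form : ∃ ε, IsNormalForm e.target (chartMetric e g) ε
  f_dt₂ : ∀ x ∈ e.target, pd 1 (fun y => fUp (chartMetric e g) y 0 0) x = 0

/-- Case II-3 at `p`: there are normal coordinates around `p` with `∂f₁¹/∂t₂ = 0`, and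
`∂h₁₂/∂t₁ = 0` in all such coordinates. (The alternative is that `∂h₁₂/∂t₁ ≠ 0` somewhere for a
suitable choice of them.) -/
structure CaseII3 (g : ∀ p : M, LinearMap.BilinForm ℝ (TangentSpace (𝓡 4) p))
    (𝒢 : Submodule ℝ (∀ p : M, TangentSpace (𝓡 4) p)) (p : M) : Prop where
  exists_chart : ∃ e, IsCaseIIChart g 𝒢 p e
  h_dt₁ : ∀ e, IsCaseIIChart g 𝒢 p e →
    ∀ x ∈ e.target, pd 0 (fun y => hMat (chartMetric e g) y 0 1) x = 0

end Manifold

/-! ### The local models -/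

/-- `e^{-2P}(dt₁² + ε dt₂²) + 2 c Q dt₁ dz₁ + ψ dz₁² + 2 dz₁ dz₂`, with `P, ψ, Q` functions of
`(t₁, t₂)`. -/
def modelMetric (ε c : ℝ) (P ψ Q : Crd 2 → ℝ) (x : Crd 4) : Matrix (Fin 4) (Fin 4) ℝ :=
  !![Real.exp (-2 * P (tPart x)), 0, c * Q (tPart x), 0;
     0, ε * Real.exp (-2 * P (tPart x)), 0, 0;
     c * Q (tPart x), 0, ψ (tPart x), 1;
     0, 0, 1, 0]

/-- `(2 Λ z₁ + a) ∂_{z₁} + A(z₁) ∂_{z₂}`. -/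
def modelField (Λ a : ℝ) (A : ℝ → ℝ) (x : Crd 4) : Crd 4 :=
  !₂[0, 0, 2 * Λ * x 2 + a, A (x 2)]

/-- `e^{-2P}(dt₁² + ε dt₂²)`. -/
def modelOrbitMetric (ε : ℝ) (P : Crd 2 → ℝ) (t : Crd 2) : Matrix (Fin 2) (Fin 2) ℝ :=
  !![Real.exp (-2 * P t), 0; 0, ε * Real.exp (-2 * P t)]

/-- The constraints on the parameters of the model over the coordinate domain `W`. The function `Q`
is an antiderivative `∫ e^{-2P} dt₂`. -/
structure IsModelData (W : Set (Crd 4)) (Λ ε c : ℝ) (P ψ Q : Crd 2 → ℝ) (A : ℝ → ℝ) : Prop where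
  sign : ε = 1 ∨ ε = -1
  c_ne : c ≠ 0
  P_smooth : ContDiffOn ℝ ∞ P (tPart '' W)
  ψ_smooth : ContDiffOn ℝ ∞ ψ (tPart '' W)
  Q_smooth : ContDiffOn ℝ ∞ Q (tPart '' W)
  A_smooth : ContDiffOn ℝ ∞ A ((fun x : Crd 4 => x 2) '' W)
  antiderivative : ∀ t ∈ tPart '' W, pd 1 Q t = Real.exp (-2 * P t)
  ψ_equation : ∀ x ∈ W,
    pd 0 (pd 0 ψ) (tPart x) + ε * pd 1 (pd 1 ψ) (tPart x)
        - 2 * Λ * Real.exp (-2 * P (tPart x)) * ψ (tPart x)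
      = ε * Real.exp (-2 * P (tPart x)) * (c ^ 2 + 2 * ε * deriv A (x 2))
  liouville : ∀ t ∈ tPart '' W,
    pd 0 (pd 0 P) t + ε * pd 1 (pd 1 P) t = Λ * Real.exp (-2 * P t)

end RicciSoliton

end

/-! Classification. In normal coordinates with `∂f₁¹/∂t₂ = 0`, the function `f₁¹` locally depends on
`t₁` alone, so the form `f₁¹ dt₁` is exact and a shift of `z₁` removes it. Normal form also survives
a conformal linear map `(s₁, s₂) ↦ (α s₁ - ε β s₂, β s₁ + α s₂)` of the base, provided `z₁, z₂` are
shifted by functions of `s` that cancel the `ds₂` terms (`exists_gauge_chart`). Case II-3 asserts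
`∂h₁₂/∂t₁ = 0` in every admissible chart. Applied to a given chart and to a rotated (`ε = 1`) or
boosted (`ε = -1`) one, it gives the derivatives of `h₁₂` in two independent directions, so `h₁₂` is
locally constant and a rescaling of `z₂` makes it `1` (`exists_pd_one_eq_zero`,
`exists_chart_modelMetric`). The metric is then `e^{-2P}(dt₁² + ε dt₂²) + 2 f dt₁ dz₁ + ψ dz₁² + 2
dz₁ dz₂`.

The distribution `Ξ^⊥` is now spanned by `∂_{t₂}` and `∂_{t₁} - f ∂_{z₂}`, whose bracket is a
multiple of `f_{,t₂}`; this is nonzero by orthogonal intransitivity. A tangent symmetry `X` commutes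
with both fields, hence its components are annihilated by `∂_{t₂}`, `∂_{t₁} - f ∂_{z₂}` and
`∂_{z₂}`: they depend on `z₁` only (`pd_coord_eq_zero`). The soliton equation is then read entry by
entry (`exists_modelData_of_soliton`): `(z₁, z₂)` makes the first component of `X` affine with slope
`2Λ`, the entries `(tᵢ, z₁)` make `e^{2P} f_{,t₂}` a constant `c`, `(t₁, t₁)` is the Liouville
equation, and `(z₁, z₁)` is the equation for `ψ`.

Converse. The Ricci tensor of the model is computed once, for arbitrary smooth coefficients
(`SmoothCoeff.ricci_eq`), and serves both directions. The Gauss curvature of `e^{-2P}(dt₁² + ε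
dt₂²)` is `e^{2P}(P_{,t₁t₁} + ε P_{,t₂t₂})`, which is `Λ` by the Liouville equation. Existence
follows from explicit solutions that depend on `t₁` only. -/

noncomputable section

namespace RicciSoliton

/-! ### Calculus of coordinate partial derivatives -/

section PartialDerivatives

variable {n : ℕ} {F H : Crd n → ℝ} {x : Crd n} {i : Fin n}

theorem pd_congr (h : F =ᶠ[nhds x] H) : pd i F x = pd i H x := by
  simp only [pd, h.fderiv_eq]

theorem pd_congr_of_eqOn {W : Set (Crd n)} (hW : IsOpen W) (hx : x ∈ W) (h : ∀ y ∈ W, F y = H y) :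
    pd i F x = pd i H x :=
  pd_congr (Filter.eventuallyEq_of_mem (hW.mem_nhds hx) h)

theorem pd_const (c : ℝ) : pd i (fun _ => c) x = 0 := by
  simp [pd]

theorem pd_zero_of_eqOn {W : Set (Crd n)} (hW : IsOpen W) (hx : x ∈ W) {c : ℝ}
    (h : ∀ y ∈ W, F y = c) : pd i F x = 0 := by
  rw [pd_congr_of_eqOn hW hx h, pd_const]

theorem pd_add (hF : DifferentiableAt ℝ F x) (hH : DifferentiableAt ℝ H x) :
    pd i (fun y => F y + H y) x = pd i F x + pd i H x := by
  simp [pd, fderiv_fun_add hF hH]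

theorem pd_mul (hF : DifferentiableAt ℝ F x) (hH : DifferentiableAt ℝ H x) :
    pd i (fun y => F y * H y) x = F x * pd i H x + H x * pd i F x := by
  simp [pd, fderiv_fun_mul hF hH]

theorem pd_const_mul (c : ℝ) : pd i (fun y => c * F y) x = c * pd i F x := by
  simp only [pd]
  change fderiv ℝ (c • F) x _ = _
  rw [fderiv_const_smul_field]; rfl

theorem pd_neg : pd i (fun y => -F y) x = -pd i F x := by
  simp [pd, fderiv_fun_neg]

theorem pd_exp (hF : DifferentiableAt ℝ F x) :
    pd i (fun y => Real.exp (F y)) x = Real.exp (F x) * pd i F x := by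
  simp [pd, fderiv_exp hF]

theorem pd_coord (k : Fin n) : pd i (fun y => y k) x = if k = i then 1 else 0 := by
  have : (fun y : Crd n => y k) = (EuclideanSpace.proj k : Crd n →L[ℝ] ℝ) := rfl
  rw [pd, this, ContinuousLinearMap.fderiv]
  simp [basisVec]

theorem contDiffOn_pd {W : Set (Crd n)} (hW : IsOpen W) (hF : ContDiffOn ℝ ∞ F W) :
    ContDiffOn ℝ ∞ (pd i F) W := fun x hx =>
  (((hF.contDiffAt (hW.mem_nhds hx)).fderiv_right (m := ∞) (by norm_cast)).clm_apply
    contDiffAt_const).contDiffWithinAt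

theorem differentiableAt_pd {W : Set (Crd n)} (hW : IsOpen W) (hF : ContDiffOn ℝ ∞ F W)
    (hx : x ∈ W) : DifferentiableAt ℝ (pd i F) x :=
  ((contDiffOn_pd hW hF).contDiffAt (hW.mem_nhds hx)).differentiableAt (by simp)

theorem pd_comm {W : Set (Crd n)} (hW : IsOpen W) (hF : ContDiffOn ℝ ∞ F W) (hx : x ∈ W)
    (j : Fin n) : pd i (pd j F) x = pd j (pd i F) x := by
  have h0 := hF.contDiffAt (hW.mem_nhds hx)
  have hs : IsSymmSndFDerivAt ℝ F x := h0.isSymmSndFDerivAt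
    (by simpa using WithTop.coe_le_coe.2 (le_top : (2 : ℕ∞) ≤ ⊤))
  have hd : DifferentiableAt ℝ (fderiv ℝ F) x :=
    (h0.fderiv_right (m := ∞) (by norm_cast)).differentiableAt (by simp)
  have key : ∀ a b : Fin n, pd a (pd b F) x = fderiv ℝ (fderiv ℝ F) x (basisVec a) (basisVec b) := by
    intro a b
    have : pd b F = fun y => (fderiv ℝ F y) (basisVec b) := rfl
    rw [this, pd, fderiv_clm_apply hd (differentiableAt_const _)]
    simp
  rw [key, key]
  exact hs _ _

end PartialDerivatives

/-! ### Functions that factor through the projection to `(t₁, t₂)` -/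

section TPart

/-- The projection `tPart` as a continuous linear map. -/
def tPartL : Crd 4 →L[ℝ] Crd 2 :=
  LinearMap.toContinuousLinearMap
    { toFun := tPart
      map_add' := fun x y => by ext i; fin_cases i <;> simp [tPart]
      map_smul' := fun c x => by ext i; fin_cases i <;> simp [tPart] }

theorem tPartL_apply (x : Crd 4) : tPartL x = tPart x := rfl

@[simp] theorem tPart_zero (x : Crd 4) : tPart x 0 = x 0 := rfl

@[simp] theorem tPart_one (x : Crd 4) : tPart x 1 = x 1 := rfl

theorem contDiff_tPart : ContDiff ℝ ∞ tPart := tPartL.contDiff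

theorem isOpen_image_tPart {W : Set (Crd 4)} (hW : IsOpen W) : IsOpen (tPart '' W) := by
  have hs : Function.Surjective tPartL := fun t =>
    ⟨!₂[t 0, t 1, 0, 0], by ext i; fin_cases i <;> simp [tPartL_apply, tPart]⟩
  exact tPartL.isOpenMap hs W hW

theorem isOpen_image_coord {n : ℕ} {W : Set (Crd n)} (hW : IsOpen W) (k : Fin n) :
    IsOpen ((fun x : Crd n => x k) '' W) := by
  have hs : Function.Surjective (EuclideanSpace.proj k : Crd n →L[ℝ] ℝ) := fun t =>
    ⟨EuclideanSpace.single k t, by simp⟩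
  exact (EuclideanSpace.proj k : Crd n →L[ℝ] ℝ).isOpenMap hs W hW

variable {u : Crd 2 → ℝ} {x : Crd 4}

theorem fderiv_comp_tPart (hu : DifferentiableAt ℝ u (tPart x)) (v : Crd 4) :
    fderiv ℝ (fun y => u (tPart y)) x v = fderiv ℝ u (tPart x) (tPart v) := by
  have h : HasFDerivAt (fun y => u (tPart y)) ((fderiv ℝ u (tPart x)).comp tPartL) x :=
    HasFDerivAt.comp x (by exact hu.hasFDerivAt) tPartL.hasFDerivAt
  rw [h.fderiv]; rfl

theorem tPart_basisVec_zero : tPart (basisVec 0) = basisVec 0 := by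
  ext i; fin_cases i <;> simp [tPart, basisVec]

theorem tPart_basisVec_one : tPart (basisVec 1) = basisVec 1 := by
  ext i; fin_cases i <;> simp [tPart, basisVec]

theorem tPart_basisVec_two : tPart (basisVec 2) = 0 := by
  ext i; fin_cases i <;> simp [tPart, basisVec]

theorem tPart_basisVec_three : tPart (basisVec 3) = 0 := by
  ext i; fin_cases i <;> simp [tPart, basisVec]

theorem pd_zero_comp_tPart (hu : DifferentiableAt ℝ u (tPart x)) :
    pd 0 (fun y => u (tPart y)) x = pd 0 u (tPart x) := by
  rw [pd, fderiv_comp_tPart hu, tPart_basisVec_zero]; rfl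

theorem pd_one_comp_tPart (hu : DifferentiableAt ℝ u (tPart x)) :
    pd 1 (fun y => u (tPart y)) x = pd 1 u (tPart x) := by
  rw [pd, fderiv_comp_tPart hu, tPart_basisVec_one]; rfl

/-- Differentiability of `u` is not needed: the function is constant along the line in direction
`v`, and where it fails to be differentiable `fderiv` takes its default value `0`. -/
theorem fderiv_comp_tPart_eq_zero {v : Crd 4} (hv : tPart v = 0) :
    fderiv ℝ (fun y => u (tPart y)) x v = 0 := by
  by_cases h : DifferentiableAt ℝ (fun y => u (tPart y)) x
  · rw [← h.lineDeriv_eq_fderiv, lineDeriv]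
    have : (fun s : ℝ => u (tPart (x + s • v))) = fun _ => u (tPart x) := by
      funext s
      rw [← tPartL_apply, map_add, map_smul, tPartL_apply, tPartL_apply, hv]; simp
    rw [this]; simp
  · rw [fderiv_zero_of_not_differentiableAt h]; rfl

theorem pd_two_comp_tPart : pd 2 (fun y => u (tPart y)) x = 0 :=
  fderiv_comp_tPart_eq_zero tPart_basisVec_two

theorem pd_three_comp_tPart : pd 3 (fun y => u (tPart y)) x = 0 :=
  fderiv_comp_tPart_eq_zero tPart_basisVec_three

end TPart

/-! ### Christoffel symbols and Ricci tensor of the model metric -/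

section ModelCurvature

variable {W : Set (Crd 4)} {ε c : ℝ} {P ψ Q : Crd 2 → ℝ}

/-- The inverse of the matrix `modelMetric`. -/
def modelInverse (ε c : ℝ) (P ψ Q : Crd 2 → ℝ) (t : Crd 2) : Matrix (Fin 4) (Fin 4) ℝ :=
  !![Real.exp (2 * P t), 0, 0, -(c * Q t) * Real.exp (2 * P t);
     0, ε * Real.exp (2 * P t), 0, 0;
     0, 0, 0, 1;
     -(c * Q t) * Real.exp (2 * P t), 0, 1, (c * Q t) ^ 2 * Real.exp (2 * P t) - ψ t]

theorem exp_neg_mul_exp (a : ℝ) : Real.exp (-(2 * a)) * Real.exp (2 * a) = 1 := by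
  rw [← Real.exp_add]; simp

theorem modelMetric_inv (hε : ε = 1 ∨ ε = -1) (x : Crd 4) :
    (modelMetric ε c P ψ Q x)⁻¹ = modelInverse ε c P ψ Q (tPart x) := by
  have he := exp_neg_mul_exp (P (tPart x))
  have hε2 : ε * ε = 1 := by rcases hε with h | h <;> simp [h]
  apply Matrix.inv_eq_right_inv
  ext i j
  fin_cases i <;> fin_cases j <;>
    simp [modelMetric, modelInverse, Matrix.mul_apply, Fin.sum_univ_four] <;> try ring1
  · exact he
  · linear_combination (-(c * Q (tPart x))) * he
  · linear_combination hε2 + ε * ε * he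

/-- The partial derivatives of the components of `modelMetric`. -/
def modelDeriv (ε c : ℝ) (P ψ Q : Crd 2 → ℝ) : Fin 4 → Crd 2 → Matrix (Fin 4) (Fin 4) ℝ :=
  fun l t => match l with
  | 0 => !![-2 * pd 0 P t * Real.exp (-2 * P t), 0, c * pd 0 Q t, 0;
      0, ε * (-2 * pd 0 P t * Real.exp (-2 * P t)), 0, 0;
      c * pd 0 Q t, 0, pd 0 ψ t, 0; 0, 0, 0, 0]
  | 1 => !![-2 * pd 1 P t * Real.exp (-2 * P t), 0, c * pd 1 Q t, 0;
      0, ε * (-2 * pd 1 P t * Real.exp (-2 * P t)), 0, 0;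
      c * pd 1 Q t, 0, pd 1 ψ t, 0; 0, 0, 0, 0]
  | _ => 0

theorem pd_exp_mul {n : ℕ} {F : Crd n → ℝ} {x : Crd n} {i : Fin n} (a : ℝ)
    (hF : DifferentiableAt ℝ F x) :
    pd i (fun y => Real.exp (a * F y)) x = a * pd i F x * Real.exp (a * F x) := by
  rw [pd_exp (hF.const_mul a), pd_const_mul]; ring

theorem pd_modelMetric_zero {x : Crd 4} (hP : DifferentiableAt ℝ P (tPart x))
    (hψ : DifferentiableAt ℝ ψ (tPart x)) (hQ : DifferentiableAt ℝ Q (tPart x))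
    (i j : Fin 4) :
    pd 0 (fun y => modelMetric ε c P ψ Q y i j) x = modelDeriv ε c P ψ Q 0 (tPart x) i j := by
  have hE := pd_zero_comp_tPart (x := x) (u := fun t => Real.exp (-2 * P t))
    ((hP.const_mul _).exp)
  rw [pd_exp_mul _ hP] at hE
  have h1 := pd_zero_comp_tPart hψ
  have h2 := pd_zero_comp_tPart hQ
  fin_cases i <;> fin_cases j <;>
    simp [modelMetric, modelDeriv, pd_const, pd_const_mul] <;> simp_all

theorem pd_modelMetric_one {x : Crd 4} (hP : DifferentiableAt ℝ P (tPart x))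
    (hψ : DifferentiableAt ℝ ψ (tPart x)) (hQ : DifferentiableAt ℝ Q (tPart x))
    (i j : Fin 4) :
    pd 1 (fun y => modelMetric ε c P ψ Q y i j) x = modelDeriv ε c P ψ Q 1 (tPart x) i j := by
  have hE := pd_one_comp_tPart (x := x) (u := fun t => Real.exp (-2 * P t))
    ((hP.const_mul _).exp)
  rw [pd_exp_mul _ hP] at hE
  have h1 := pd_one_comp_tPart hψ
  have h2 := pd_one_comp_tPart hQ
  fin_cases i <;> fin_cases j <;>
    simp [modelMetric, modelDeriv, pd_const, pd_const_mul] <;> simp_all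

theorem modelMetric_eq_comp_tPart (i j : Fin 4) :
    (fun y => modelMetric ε c P ψ Q y i j)
      = fun y => (fun t => modelMetric ε c P ψ Q !₂[t 0, t 1, 0, 0] i j) (tPart y) := by
  funext y
  have : tPart !₂[tPart y 0, tPart y 1, 0, 0] = tPart y := by
    ext i; fin_cases i <;> simp [tPart]
  simp only [modelMetric, this]

theorem pd_modelMetric_two (x : Crd 4) (i j : Fin 4) :
    pd 2 (fun y => modelMetric ε c P ψ Q y i j) x = 0 := by
  rw [modelMetric_eq_comp_tPart]
  exact pd_two_comp_tPart (u := fun t => modelMetric ε c P ψ Q !₂[t 0, t 1, 0, 0] i j)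

theorem pd_modelMetric_three (x : Crd 4) (i j : Fin 4) :
    pd 3 (fun y => modelMetric ε c P ψ Q y i j) x = 0 := by
  rw [modelMetric_eq_comp_tPart]
  exact pd_three_comp_tPart (u := fun t => modelMetric ε c P ψ Q !₂[t 0, t 1, 0, 0] i j)

theorem pd_modelMetric {x : Crd 4} (hP : DifferentiableAt ℝ P (tPart x))
    (hψ : DifferentiableAt ℝ ψ (tPart x)) (hQ : DifferentiableAt ℝ Q (tPart x))
    (l i j : Fin 4) :
    pd l (fun y => modelMetric ε c P ψ Q y i j) x = modelDeriv ε c P ψ Q l (tPart x) i j := by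
  fin_cases l
  · exact pd_modelMetric_zero hP hψ hQ i j
  · exact pd_modelMetric_one hP hψ hQ i j
  · simpa [modelDeriv] using pd_modelMetric_two x i j
  · simpa [modelDeriv] using pd_modelMetric_three x i j

/-- The Christoffel symbols of `modelMetric`, as functions of `(t₁, t₂)`. -/
def modelChristoffel (ε c : ℝ) (P ψ Q : Crd 2 → ℝ) (k i j : Fin 4) (t : Crd 2) : ℝ :=
  (1 / 2) * ∑ l, modelInverse ε c P ψ Q t k l *
    (modelDeriv ε c P ψ Q i t j l + modelDeriv ε c P ψ Q j t i l - modelDeriv ε c P ψ Q l t i j)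

/-- Smoothness of the coefficient functions over the domain. -/
structure SmoothCoeff (W : Set (Crd 4)) (ε : ℝ) (P ψ Q : Crd 2 → ℝ) : Prop where
  isOpen : IsOpen W
  sign : ε = 1 ∨ ε = -1
  P_smooth : ContDiffOn ℝ ∞ P (tPart '' W)
  ψ_smooth : ContDiffOn ℝ ∞ ψ (tPart '' W)
  Q_smooth : ContDiffOn ℝ ∞ Q (tPart '' W)

theorem differentiableAt_of_mem {n : ℕ} {F : Crd n → ℝ} {T : Set (Crd n)} (hT : IsOpen T)
    (hF : ContDiffOn ℝ ∞ F T) {t : Crd n} (ht : t ∈ T) : DifferentiableAt ℝ F t :=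
  (hF.contDiffAt (hT.mem_nhds ht)).differentiableAt (by simp)

namespace SmoothCoeff

theorem christoffel_eq (h : SmoothCoeff W ε P ψ Q) {x : Crd 4} (hx : x ∈ W) (k i j : Fin 4) :
    christoffel (modelMetric ε c P ψ Q) k i j x = modelChristoffel ε c P ψ Q k i j (tPart x) := by
  have hT := isOpen_image_tPart h.isOpen
  have ht : tPart x ∈ tPart '' W := ⟨x, hx, rfl⟩
  have hP := differentiableAt_of_mem hT h.P_smooth ht
  have hψ := differentiableAt_of_mem hT h.ψ_smooth ht
  have hQ := differentiableAt_of_mem hT h.Q_smooth ht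
  simp only [christoffel, modelChristoffel, modelMetric_inv h.sign, pd_modelMetric hP hψ hQ]

theorem pd_christoffel (h : SmoothCoeff W ε P ψ Q) {x : Crd 4} (hx : x ∈ W) (k i j l : Fin 4) :
    pd l (christoffel (modelMetric ε c P ψ Q) k i j) x
      = pd l (fun y => modelChristoffel ε c P ψ Q k i j (tPart y)) x :=
  pd_congr_of_eqOn h.isOpen hx fun _ hy => h.christoffel_eq hy k i j

end SmoothCoeff

section Table

variable (t : Crd 2)

theorem modelChristoffel_symm (k i j : Fin 4) :
    modelChristoffel ε c P ψ Q k i j = modelChristoffel ε c P ψ Q k j i := by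
  funext t
  have : ∀ l, modelDeriv ε c P ψ Q l t i j = modelDeriv ε c P ψ Q l t j i := by
    intro l
    fin_cases l <;> fin_cases i <;> fin_cases j <;> simp [modelDeriv]
  simp only [modelChristoffel, this, add_comm]

local notation "Γ" => modelChristoffel ε c P ψ Q

/-- The field `∂_{z₂}` is Killing and its metric dual `dz₁` is closed, so both are parallel. For
`dz₁` this is the vanishing of `Γ²ᵢⱼ`; for `∂_{z₂}` it is the vanishing of `Γᵏᵢ₃` in the next lemma.
-/
theorem modelChristoffel_two (i j : Fin 4) : Γ 2 i j = fun _ => 0 := by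
  funext t
  fin_cases i <;> fin_cases j <;>
    simp [modelChristoffel, modelDeriv, modelInverse, Fin.sum_univ_four]

theorem modelChristoffel_lower_three (k i : Fin 4) : Γ k i 3 = fun _ => 0 := by
  funext t
  fin_cases k <;> fin_cases i <;>
    simp [modelChristoffel, modelDeriv, modelInverse, Fin.sum_univ_four]

theorem modelChristoffel_lower_three' (k i : Fin 4) : Γ k 3 i = fun _ => 0 := by
  rw [modelChristoffel_symm, modelChristoffel_lower_three]

theorem modelChristoffel_zero (i j : Fin 4) : Γ 0 i j = fun t =>
    (!![-pd 0 P t, -pd 1 P t, 0, 0;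
        -pd 1 P t, ε * pd 0 P t, (c / 2) * (pd 1 Q t * Real.exp (2 * P t)), 0;
        0, (c / 2) * (pd 1 Q t * Real.exp (2 * P t)),
          (-1 / 2) * (pd 0 ψ t * Real.exp (2 * P t)), 0;
        0, 0, 0, 0] : Matrix (Fin 4) (Fin 4) ℝ) i j := by
  funext t
  have he := exp_neg_mul_exp (P t)
  fin_cases i <;> fin_cases j <;>
    simp [modelChristoffel, modelDeriv, modelInverse, Fin.sum_univ_four] <;> try ring1
  · linear_combination pd 0 P t * he
  · linear_combination pd 1 P t * he
  · linear_combination pd 1 P t * he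
  · linear_combination (ε * pd 0 P t) * he

theorem modelChristoffel_one (hε : ε = 1 ∨ ε = -1) (i j : Fin 4) : Γ 1 i j = fun t =>
    (!![ε * pd 1 P t, -pd 0 P t, (-ε * c / 2) * (pd 1 Q t * Real.exp (2 * P t)), 0;
        -pd 0 P t, -pd 1 P t, 0, 0;
        (-ε * c / 2) * (pd 1 Q t * Real.exp (2 * P t)), 0,
          (-ε / 2) * (pd 1 ψ t * Real.exp (2 * P t)), 0;
        0, 0, 0, 0] : Matrix (Fin 4) (Fin 4) ℝ) i j := by
  funext t
  have he := exp_neg_mul_exp (P t)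
  have hε2 : ε * ε = 1 := by rcases hε with h | h <;> simp [h]
  fin_cases i <;> fin_cases j <;>
    simp [modelChristoffel, modelDeriv, modelInverse, Fin.sum_univ_four] <;> try ring1
  · linear_combination (ε * pd 1 P t) * he
  · linear_combination (pd 0 P t * ε * ε) * he + pd 0 P t * hε2
  · linear_combination (pd 0 P t * ε * ε) * he + pd 0 P t * hε2
  · linear_combination (pd 1 P t * ε * ε) * he + pd 1 P t * hε2

end Table

theorem pd_mul_exp {n : ℕ} {F P : Crd n → ℝ} {t : Crd n} {i : Fin n}
    (hF : DifferentiableAt ℝ F t) (hP : DifferentiableAt ℝ P t) :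
    pd i (fun t => F t * Real.exp (2 * P t)) t
      = (pd i F t + 2 * pd i P t * F t) * Real.exp (2 * P t) := by
  rw [pd_mul hF ((hP.const_mul _).exp), pd_exp_mul _ hP]; ring

/-- The Ricci tensor of `modelMetric`, as a function of `(t₁, t₂)`. -/
def modelRicci (ε c : ℝ) (P ψ Q : Crd 2 → ℝ) (t : Crd 2) : Matrix (Fin 4) (Fin 4) ℝ :=
  let K := pd 0 (pd 0 P) t + ε * pd 1 (pd 1 P) t
  let r₀ := (-ε * c / 2) * (pd 1 (pd 1 Q) t + 2 * pd 1 P t * pd 1 Q t) * Real.exp (2 * P t)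
  let r₁ := (c / 2) * (pd 0 (pd 1 Q) t + 2 * pd 0 P t * pd 1 Q t) * Real.exp (2 * P t)
  !![K, 0, r₀, 0;
     0, ε * K, r₁, 0;
     r₀, r₁, (-1 / 2) * (pd 0 (pd 0 ψ) t + ε * pd 1 (pd 1 ψ) t) * Real.exp (2 * P t)
       + (ε * c ^ 2 / 2) * (pd 1 Q t * Real.exp (2 * P t)) ^ 2, 0;
     0, 0, 0, 0]

/-- The symbols `Γ³ᵢⱼ`, the complicated ones, never enter: in the contracted curvature they occur
either under `∂_{z₂}`, which kills functions of `(t₁, t₂)`, or with a lower index `3`, or multiplied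
by a symbol with lower index `3`. The tables for the upper indices `0, 1, 2` therefore suffice. -/
theorem SmoothCoeff.ricci_eq (h : SmoothCoeff W ε P ψ Q) {x : Crd 4} (hx : x ∈ W) (k j : Fin 4) :
    ricci (modelMetric ε c P ψ Q) k j x = modelRicci ε c P ψ Q (tPart x) k j := by
  have hT := isOpen_image_tPart h.isOpen
  have ht : tPart x ∈ tPart '' W := ⟨x, hx, rfl⟩
  have hP := differentiableAt_of_mem hT h.P_smooth ht
  have hP0 := differentiableAt_pd (i := 0) hT h.P_smooth ht
  have hP1 := differentiableAt_pd (i := 1) hT h.P_smooth ht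
  have hψ0 := differentiableAt_pd (i := 0) hT h.ψ_smooth ht
  have hψ1 := differentiableAt_pd (i := 1) hT h.ψ_smooth ht
  have hQ1 := differentiableAt_pd (i := 1) hT h.Q_smooth ht
  have hPc := pd_comm (i := 1) hT h.P_smooth ht 0
  have hE := (hP.const_mul 2).exp
  have e0 : ∀ F : Crd 2 → ℝ, DifferentiableAt ℝ F (tPart x) →
      pd 0 (fun y => F (tPart y) * Real.exp (2 * P (tPart y))) x
        = (pd 0 F (tPart x) + 2 * pd 0 P (tPart x) * F (tPart x)) * Real.exp (2 * P (tPart x)) :=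
    fun F hF => by
      rw [← pd_mul_exp hF hP]
      exact pd_zero_comp_tPart (u := fun t => F t * Real.exp (2 * P t)) (hF.mul hE)
  have e1 : ∀ F : Crd 2 → ℝ, DifferentiableAt ℝ F (tPart x) →
      pd 1 (fun y => F (tPart y) * Real.exp (2 * P (tPart y))) x
        = (pd 1 F (tPart x) + 2 * pd 1 P (tPart x) * F (tPart x)) * Real.exp (2 * P (tPart x)) :=
    fun F hF => by
      rw [← pd_mul_exp hF hP]
      exact pd_one_comp_tPart (u := fun t => F t * Real.exp (2 * P t)) (hF.mul hE)
  have z2 : ∀ F : Crd 2 → ℝ, pd 2 (fun y => F (tPart y)) x = 0 := fun F => pd_two_comp_tPart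
  have z3 : ∀ F : Crd 2 → ℝ, pd 3 (fun y => F (tPart y)) x = 0 := fun F => pd_three_comp_tPart
  simp only [ricci, riemann, Fin.sum_univ_four, h.pd_christoffel hx, h.christoffel_eq hx, z3,
    modelChristoffel_two, modelChristoffel_lower_three, modelChristoffel_lower_three',
    modelChristoffel_zero, modelChristoffel_one h.sign]
  fin_cases k <;> fin_cases j <;>
  simp [modelRicci, pd_const, pd_neg, pd_const_mul, pd_zero_comp_tPart hP0,
    pd_zero_comp_tPart hP1, pd_one_comp_tPart hP0, pd_one_comp_tPart hP1,
    e0 _ hψ0, e0 _ hQ1, e1 _ hψ1, e1 _ hQ1, z2, z3, hPc] <;>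
  first | ring1 | (rcases h.sign with h | h <;> rw [h] <;> ring1)

end ModelCurvature

/-! ### Gauss curvature of the orbit metric -/

section OrbitCurvature

variable {T : Set (Crd 2)} {ε : ℝ} {P : Crd 2 → ℝ}

theorem modelOrbitMetric_inv (hε : ε = 1 ∨ ε = -1) (t : Crd 2) :
    (modelOrbitMetric ε P t)⁻¹ = !![Real.exp (2 * P t), 0; 0, ε * Real.exp (2 * P t)] := by
  have he := exp_neg_mul_exp (P t)
  have hε2 : ε * ε = 1 := by rcases hε with h | h <;> simp [h]
  apply Matrix.inv_eq_right_inv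
  ext i j
  fin_cases i <;> fin_cases j <;> simp [modelOrbitMetric, Matrix.mul_apply]
  · exact he
  · linear_combination hε2 + ε * ε * he

theorem pd_modelOrbitMetric {t : Crd 2} (hP : DifferentiableAt ℝ P t) (l i j : Fin 2) :
    pd l (fun y => modelOrbitMetric ε P y i j) t
      = -2 * pd l P t * modelOrbitMetric ε P t i j := by
  have h := pd_exp_mul (i := l) (-2) hP
  fin_cases i <;> fin_cases j <;> simp [modelOrbitMetric, pd_const, pd_const_mul] <;> simp_all
  ring

/-- The Christoffel symbols of `modelOrbitMetric`. -/
def orbitChristoffel (ε : ℝ) (P : Crd 2 → ℝ) (k i j : Fin 2) (t : Crd 2) : ℝ :=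
  match k with
  | 0 => (!![-pd 0 P t, -pd 1 P t; -pd 1 P t, ε * pd 0 P t] : Matrix (Fin 2) (Fin 2) ℝ) i j
  | 1 => (!![ε * pd 1 P t, -pd 0 P t; -pd 0 P t, -pd 1 P t] : Matrix (Fin 2) (Fin 2) ℝ) i j

theorem christoffel_modelOrbitMetric (hε : ε = 1 ∨ ε = -1) {t : Crd 2}
    (hP : DifferentiableAt ℝ P t) (k i j : Fin 2) :
    christoffel (modelOrbitMetric ε P) k i j t = orbitChristoffel ε P k i j t := by
  have he := exp_neg_mul_exp (P t)
  simp only [christoffel, modelOrbitMetric_inv hε, pd_modelOrbitMetric hP]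
  rcases hε with rfl | rfl <;> fin_cases k <;> fin_cases i <;> fin_cases j <;>
    simp [modelOrbitMetric, orbitChristoffel]
  all_goals first
    | linear_combination pd 0 P t * he
    | linear_combination (-pd 0 P t) * he
    | linear_combination pd 1 P t * he

/-- This is the curvature formula for a metric conformal to the flat `dt₁² + ε dt₂²`, valid for both
signatures. -/
theorem gaussCurvature_modelOrbitMetric (hε : ε = 1 ∨ ε = -1) (hT : IsOpen T)
    (hP : ContDiffOn ℝ ∞ P T) {t : Crd 2} (ht : t ∈ T) :
    gaussCurvature (modelOrbitMetric ε P) t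
      = (pd 0 (pd 0 P) t + ε * pd 1 (pd 1 P) t) * Real.exp (2 * P t) := by
  have he := exp_neg_mul_exp (P t)
  have hc : ∀ k i j, ∀ y ∈ T, christoffel (modelOrbitMetric ε P) k i j y
      = orbitChristoffel ε P k i j y := fun k i j y hy =>
    christoffel_modelOrbitMetric hε (differentiableAt_of_mem hT hP hy) k i j
  have hpc : ∀ k i j l, pd l (christoffel (modelOrbitMetric ε P) k i j) t
      = pd l (fun y => orbitChristoffel ε P k i j y) t := fun k i j l =>
    pd_congr_of_eqOn hT ht (hc k i j)
  have hE : Real.exp (-(2 * P t)) ≠ 0 := (Real.exp_pos _).ne'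
  simp [gaussCurvature, riemann, hpc, hc _ _ _ t ht, orbitChristoffel, pd_const_mul, pd_neg,
    modelOrbitMetric, Matrix.det_fin_two]
  rcases hε with rfl | rfl
  · field_simp
    linear_combination (-(pd 0 (pd 0 P) t + pd 1 (pd 1 P) t)) * he
  · field_simp
    linear_combination (-(pd 0 (pd 0 P) t - pd 1 (pd 1 P) t)) * he

end OrbitCurvature

/-! ### Lie brackets in coordinates, and the converse: models satisfy all the conditions -/

theorem fderiv_coord {n : ℕ} {Y : Crd 4 → Crd n} {x : Crd 4} (hY : DifferentiableAt ℝ Y x)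
    (v : Crd 4) (k : Fin n) : (fderiv ℝ Y x v) k = fderiv ℝ (fun y => Y y k) x v := by
  have h : HasFDerivAt (fun y => Y y k) ((EuclideanSpace.proj k : Crd n →L[ℝ] ℝ).comp
    (fderiv ℝ Y x)) x :=
    (EuclideanSpace.proj k : Crd n →L[ℝ] ℝ).hasFDerivAt.comp x hY.hasFDerivAt
  rw [h.fderiv]; rfl

theorem lieBracket_coord {V Y : Crd 4 → Crd 4} {x : Crd 4} (hV : DifferentiableAt ℝ V x)
    (hY : DifferentiableAt ℝ Y x) (k : Fin 4) :
    VectorField.lieBracket ℝ V Y x k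
      = fderiv ℝ (fun y => Y y k) x (V x) - fderiv ℝ (fun y => V y k) x (Y x) := by
  rw [VectorField.lieBracket, PiLp.sub_apply, fderiv_coord hY, fderiv_coord hV]

section Model

variable {W : Set (Crd 4)} {Λ ε a c : ℝ} {P ψ Q : Crd 2 → ℝ} {A : ℝ → ℝ}

theorem IsModelData.smoothCoeff (h : IsModelData W Λ ε c P ψ Q A) (hW : IsOpen W) :
    SmoothCoeff W ε P ψ Q :=
  ⟨hW, h.sign, h.P_smooth, h.ψ_smooth, h.Q_smooth⟩

theorem hMat_modelMetric (x : Crd 4) :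
    hMat (modelMetric ε c P ψ Q) x = !![ψ (tPart x), 1; 1, 0] := by
  simp [hMat, modelMetric]

theorem hMat_modelMetric_inv (x : Crd 4) :
    (hMat (modelMetric ε c P ψ Q) x)⁻¹ = !![0, 1; 1, -ψ (tPart x)] := by
  rw [hMat_modelMetric]
  apply Matrix.inv_eq_right_inv
  ext i j
  fin_cases i <;> fin_cases j <;> simp

theorem fUp_modelMetric (x : Crd 4) :
    fUp (modelMetric ε c P ψ Q) x = !![0, c * Q (tPart x); 0, 0] := by
  rw [fUp, hMat_modelMetric_inv]
  ext i j
  fin_cases i <;> fin_cases j <;> simp [fMat, modelMetric]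

theorem orbitMetric_modelMetric (x : Crd 4) :
    orbitMetric (modelMetric ε c P ψ Q) x = modelOrbitMetric ε P (tPart x) := by
  have h := fUp_modelMetric (ε := ε) (c := c) (P := P) (ψ := ψ) (Q := Q) x
  rw [fUp] at h
  rw [orbitMetric, h]
  ext i j
  fin_cases i <;> fin_cases j <;>
    simp [fMat, bMat, modelMetric, modelOrbitMetric, Matrix.vecMul,
      Matrix.vecHead, Matrix.vecTail]

theorem modelMetric_isSymm (x : Crd 4) : (modelMetric ε c P ψ Q x).IsSymm := by
  ext i j
  fin_cases i <;> fin_cases j <;> simp [modelMetric]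

theorem modelMetric_det_ne (hε : ε = 1 ∨ ε = -1) (x : Crd 4) :
    (modelMetric ε c P ψ Q x).det ≠ 0 := by
  have hE := (Real.exp_pos (-(2 * P (tPart x)))).ne'
  rcases hε with rfl | rfl <;>
    simp [modelMetric, Matrix.det_succ_row_zero, Fin.sum_univ_succ, Fin.succAbove, hE]

theorem contDiffOn_comp_tPart {u : Crd 2 → ℝ} (hu : ContDiffOn ℝ ∞ u (tPart '' W)) :
    ContDiffOn ℝ ∞ (fun x => u (tPart x)) W :=
  hu.comp contDiff_tPart.contDiffOn fun x hx => ⟨x, hx, rfl⟩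

theorem SmoothCoeff.contDiffOn_modelMetric (h : SmoothCoeff W ε P ψ Q) (i j : Fin 4) :
    ContDiffOn ℝ ∞ (fun x => modelMetric ε c P ψ Q x i j) W := by
  have hE : ContDiffOn ℝ ∞ (fun x => Real.exp (-(2 * P (tPart x)))) W :=
    ((contDiffOn_const.mul (contDiffOn_comp_tPart h.P_smooth)).neg).exp
  have hψ := contDiffOn_comp_tPart h.ψ_smooth
  have hQ := contDiffOn_comp_tPart h.Q_smooth
  have hEε := (contDiffOn_const (c := ε)).mul hE
  have hcQ := (contDiffOn_const (c := c)).mul hQ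
  fin_cases i <;> fin_cases j <;> simp [modelMetric] <;>
    first | exact contDiffOn_const | assumption

theorem contDiffOn_modelField (hA : ContDiffOn ℝ ∞ A ((fun x : Crd 4 => x 2) '' W)) :
    ContDiffOn ℝ ∞ (modelField Λ a A) W := by
  have h2 : ContDiff ℝ ∞ (fun x : Crd 4 => x 2) :=
    (EuclideanSpace.proj 2 : Crd 4 →L[ℝ] ℝ).contDiff
  rw [contDiffOn_euclidean]
  intro i
  fin_cases i <;> simp [modelField]
  · exact contDiffOn_const
  · exact contDiffOn_const
  · exact ((contDiff_const.mul h2).add contDiff_const).contDiffOn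
  · exact hA.comp h2.contDiffOn fun x hx => ⟨x, hx, rfl⟩

theorem pd_comp_coord {n : ℕ} {A : ℝ → ℝ} {x : Crd n} {k : Fin n}
    (hA : DifferentiableAt ℝ A (x k)) (i : Fin n) : pd i (fun y => A (y k)) x = if k = i then deriv A (x k) else 0 := by
  have h : HasFDerivAt (fun y : Crd n => A (y k))
      ((deriv A (x k)) • (EuclideanSpace.proj k : Crd n →L[ℝ] ℝ)) x :=
    hA.hasDerivAt.comp_hasFDerivAt x (EuclideanSpace.proj k : Crd n →L[ℝ] ℝ).hasFDerivAt
  rw [pd, h.fderiv]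
  simp [basisVec]

/-- The Lie derivative of `modelMetric` along a field `X¹(z₁) ∂_{z₁} + X²(z₁) ∂_{z₂}` with
`X¹' = b` and `X²' = b'`. -/
def leafLie (c : ℝ) (ψ Q : Crd 2 → ℝ) (b b' : ℝ) (t : Crd 2) : Matrix (Fin 4) (Fin 4) ℝ :=
  !![0, 0, c * Q t * b, 0;
     0, 0, 0, 0;
     c * Q t * b, 0, 2 * (ψ t * b + b'), b;
     0, 0, b, 0]

/-- A field tangent to the leaves differentiates the components of the metric only along `z₁, z₂`,
where they are constant; what remains is the contraction of the metric with the derivatives of the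
field. -/
theorem lieMetric_modelMetric_eq {x : Crd 4} {V : Crd 4 → Crd 4} (h0 : V x 0 = 0) (h1 : V x 1 = 0)
    (hd0 : ∀ i, pd i (fun y => V y 0) x = 0) (hd1 : ∀ i, pd i (fun y => V y 1) x = 0)
    {b b' : ℝ} (hd2 : ∀ i, pd i (fun y => V y 2) x = if i = 2 then b else 0)
    (hd3 : ∀ i, pd i (fun y => V y 3) x = if i = 2 then b' else 0) (i j : Fin 4) :
    lieMetric (modelMetric ε c P ψ Q) V i j x = leafLie c ψ Q b b' (tPart x) i j := by
  simp only [lieMetric, Fin.sum_univ_four, pd_modelMetric_two, pd_modelMetric_three, h0, h1, hd0,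
    hd1, hd2, hd3]
  fin_cases i <;> fin_cases j <;> simp [modelMetric, leafLie]
  ring

/-- Since `Q_{,t₂} e^{2P} = 1`, the entries `(tᵢ, z₁)` of the Ricci tensor vanish. The slope `2Λ` of
the first component of the field produces `Λ g` in the entries `(t₁, z₁)` and `(z₁, z₂)`; the
diagonal entries are the Liouville equation and the equation for `ψ`. -/
theorem IsModelData.solitonEquationOn (h : IsModelData W Λ ε c P ψ Q A) (hW : IsOpen W) :
    SolitonEquationOn W (modelMetric ε c P ψ Q) (modelField Λ a A) Λ := by
  intro x hx i j
  have hs := h.smoothCoeff hW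
  have hT := isOpen_image_tPart hW
  have ht : tPart x ∈ tPart '' W := ⟨x, hx, rfl⟩
  have hP := differentiableAt_of_mem hT h.P_smooth ht
  have hA : DifferentiableAt ℝ A (x 2) :=
    (h.A_smooth.contDiffAt ((isOpen_image_coord hW 2).mem_nhds ⟨x, hx, rfl⟩)).differentiableAt
      (by simp)
  have hlie : lieMetric (modelMetric ε c P ψ Q) (modelField Λ a A) i j x
      = leafLie c ψ Q (2 * Λ) (deriv A (x 2)) (tPart x) i j := by
    refine lieMetric_modelMetric_eq (by simp [modelField]) (by simp [modelField]) (fun i => ?_)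
      (fun i => ?_) (fun i => ?_) (fun i => ?_) i j
    · simp [modelField, pd_const]
    · simp [modelField, pd_const]
    · have hd : DifferentiableAt ℝ (fun y : Crd 4 => y 2) x :=
        (EuclideanSpace.proj 2 : Crd 4 →L[ℝ] ℝ).differentiableAt
      simp [modelField, pd_add (hd.const_mul (2 * Λ)) (differentiableAt_const a), pd_const_mul,
        pd_coord, pd_const, eq_comm]
    · simp [modelField, pd_comp_coord hA, eq_comm]
  rw [hlie, hs.ricci_eq hx]
  have hL := h.liouville _ ht
  have hψ := h.ψ_equation x hx
  have hQ1 : ∀ y ∈ tPart '' W, pd 1 Q y = Real.exp (-2 * P y) := h.antiderivative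
  have hQ11 : pd 1 (pd 1 Q) (tPart x) = -2 * pd 1 P (tPart x) * Real.exp (-2 * P (tPart x)) := by
    rw [pd_congr_of_eqOn hT ht hQ1, pd_exp_mul _ hP]
  have hQ01 : pd 0 (pd 1 Q) (tPart x) = -2 * pd 0 P (tPart x) * Real.exp (-2 * P (tPart x)) := by
    rw [pd_congr_of_eqOn hT ht hQ1, pd_exp_mul _ hP]
  have hQ1x := hQ1 _ ht
  have he := exp_neg_mul_exp (P (tPart x))
  have hε2 : ε * ε = 1 := by rcases h.sign with h | h <;> simp [h]
  rw [neg_mul] at hL hψ hQ11 hQ01 hQ1x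
  fin_cases i <;> fin_cases j <;> simp [modelRicci, leafLie, modelMetric, hQ11, hQ01, hQ1x] <;>
    try ring1
  · linear_combination hL
  · linear_combination ε * hL
  · linear_combination (-1 / 2 * Real.exp (2 * P (tPart x))) * hψ + (ε * c ^ 2 / 2 *
      (Real.exp (-(2 * P (tPart x))) * Real.exp (2 * P (tPart x)) + 1) - Λ * ψ (tPart x)
      - ε / 2 * (c ^ 2 + 2 * ε * deriv A (x 2))) * he - deriv A (x 2) * hε2

theorem IsModelData.adaptedConditions (h : IsModelData W Λ ε c P ψ Q A) (hW : IsOpen W) :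
    AdaptedConditions W (modelMetric ε c P ψ Q) (modelField Λ a A) := by
  have hT := isOpen_image_tPart hW
  have hcurv0 : ∀ x, curvatureField (modelMetric ε c P ψ Q) x 0 = 0 := fun x => by
    simp [curvatureField, fUp_modelMetric, pd_const]
  refine ⟨fun x _ => ?_, fun x hx h0 => ?_, fun x _ => ?_, fun x _ => ?_, ?_⟩
  · rw [hMat_modelMetric]; simp [Matrix.det_fin_two]
  · have ht : tPart x ∈ tPart '' W := ⟨x, hx, rfl⟩
    have h1 := congrFun h0 1
    have hdet : (orbitMetric (modelMetric ε c P ψ Q) x).det ≠ 0 := by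
      rw [orbitMetric_modelMetric]
      have hE := (Real.exp_pos (-(2 * P (tPart x)))).ne'
      rcases h.sign with rfl | rfl <;> simp [modelOrbitMetric, Matrix.det_fin_two]
    have hQ := differentiableAt_of_mem hT h.Q_smooth ht
    simp only [curvatureField, fUp_modelMetric, Pi.zero_apply, div_eq_zero_iff] at h1
    rcases h1 with h1 | h1
    · simp [pd_const, pd_const_mul, pd_one_comp_tPart hQ, h.antiderivative _ ht, h.c_ne] at h1
    · exact (Real.sqrt_pos.2 (abs_pos.2 hdet)).ne' h1
  · simp [Fin.sum_univ_two, hcurv0, hMat_modelMetric]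
  · simp [modelField]
  · intro O hO hOW Y hY horth x hx
    have hV : DifferentiableAt ℝ (modelField Λ a A) x :=
      ((contDiffOn_modelField h.A_smooth).contDiffAt (hW.mem_nhds (hOW hx))).differentiableAt
        (by simp)
    have hYx : DifferentiableAt ℝ Y x :=
      (hY.contDiffAt (hO.mem_nhds hx)).differentiableAt (by simp)
    -- Sections of `Ξ^⊥` are the fields with `Y² = 0` and `Y³ = -cQ Y⁰` (indices from `0`). Both
    -- relations persist for the bracket: `X` annihilates `Q`, and the components of `X` depend on
    -- `z₁` alone, a direction in which `Y` has no component.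
    have hY2 : ∀ y ∈ O, Y y 2 = 0 := fun y hy => by
      simpa [Fin.sum_univ_four, modelMetric] using (horth y hy).2
    have hY3 : ∀ y ∈ O, Y y 3 = -(c * Q (tPart y)) * Y y 0 := fun y hy => by
      have := (horth y hy).1
      simp [Fin.sum_univ_four, modelMetric, hY2 y hy] at this
      linear_combination this
    have ht : tPart x ∈ tPart '' W := ⟨x, hOW hx, rfl⟩
    have hQ := differentiableAt_of_mem hT h.Q_smooth ht
    have hY0d : DifferentiableAt ℝ (fun y => Y y 0) x :=
      (EuclideanSpace.proj 0 : Crd 4 →L[ℝ] ℝ).differentiableAt.comp x hYx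
    have hQd : DifferentiableAt ℝ (fun y => -(c * Q (tPart y))) x :=
      ((DifferentiableAt.comp x hQ tPartL.differentiableAt).const_mul c).neg
    have hVx : tPart (modelField Λ a A x) = 0 := by
      ext i; fin_cases i <;> simp [tPart, modelField]
    have d2 : fderiv ℝ (fun y => Y y 2) x = 0 := by
      rw [(Filter.eventuallyEq_of_mem (hO.mem_nhds hx) hY2 :
        (fun y => Y y 2) =ᶠ[nhds x] fun _ => 0).fderiv_eq]
      simp
    have d3 : fderiv ℝ (fun y => Y y 3) x (modelField Λ a A x)
        = -(c * Q (tPart x)) * fderiv ℝ (fun y => Y y 0) x (modelField Λ a A x) := by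
      rw [(Filter.eventuallyEq_of_mem (hO.mem_nhds hx) hY3 :
        (fun y => Y y 3) =ᶠ[nhds x] fun y => -(c * Q (tPart y)) * Y y 0).fderiv_eq,
        fderiv_fun_mul hQd hY0d]
      have := fderiv_comp_tPart_eq_zero (u := fun t => c * Q t) (x := x) hVx
      simp [this]
    have b0 : VectorField.lieBracket ℝ (modelField Λ a A) Y x 0
        = fderiv ℝ (fun y => Y y 0) x (modelField Λ a A x) := by
      rw [lieBracket_coord hV hYx]; simp [modelField]
    have b2 : VectorField.lieBracket ℝ (modelField Λ a A) Y x 2 = 0 := by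
      rw [lieBracket_coord hV hYx, d2]
      have e : (fun y => modelField Λ a A y 2) = fun y : Crd 4 => 2 * Λ * y 2 + a := by
        funext y; simp [modelField]
      have hh : HasFDerivAt (fun y : Crd 4 => 2 * Λ * y 2 + a)
          ((2 * Λ) • (EuclideanSpace.proj 2 : Crd 4 →L[ℝ] ℝ)) x :=
        ((EuclideanSpace.proj 2 : Crd 4 →L[ℝ] ℝ).hasFDerivAt.const_mul (2 * Λ)).add_const a
      rw [e, hh.fderiv]
      simp [hY2 x hx]
    have b3 : VectorField.lieBracket ℝ (modelField Λ a A) Y x 3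
        = -(c * Q (tPart x)) * fderiv ℝ (fun y => Y y 0) x (modelField Λ a A x) := by
      have hA : DifferentiableAt ℝ A (x 2) :=
        (h.A_smooth.contDiffAt
          ((isOpen_image_coord hW 2).mem_nhds ⟨x, hOW hx, rfl⟩)).differentiableAt (by simp)
      rw [lieBracket_coord hV hYx, d3]
      have e : (fun y => modelField Λ a A y 3) = fun y : Crd 4 => A (y 2) := by
        funext y; simp [modelField]
      have hh : HasFDerivAt (fun y : Crd 4 => A (y 2))
          (deriv A (x 2) • (EuclideanSpace.proj 2 : Crd 4 →L[ℝ] ℝ)) x :=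
        hA.hasDerivAt.comp_hasFDerivAt x (EuclideanSpace.proj 2 : Crd 4 →L[ℝ] ℝ).hasFDerivAt
      rw [e, hh.fderiv]
      simp [hY2 x hx]
    constructor
    · simp [Fin.sum_univ_four, modelMetric, b0, b2, b3]
    · simp [Fin.sum_univ_four, modelMetric, b2]

theorem isKillingOn_modelMetric {k : Fin 4} (hk : k = 2 ∨ k = 3) :
    IsKillingOn W (modelMetric ε c P ψ Q) (fun _ => basisVec k) := by
  intro x _ i j
  rcases hk with rfl | rfl <;>
    simp [lieMetric, pd_const, basisVec, pd_modelMetric_two,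
      pd_modelMetric_three]

theorem isNormalForm_modelMetric (hε : ε = 1 ∨ ε = -1) :
    IsNormalForm W (modelMetric ε c P ψ Q) ε :=
  ⟨hε, fun x _ => by simp [modelMetric],
    ⟨fun x => P (tPart x), fun x _ => orbitMetric_modelMetric x⟩,
    fun x _ => by simp [fUp_modelMetric]⟩

end Model

/-! ### Existence of model data for every `Λ` and both signs -/

theorem exists_modelData (Λ ε : ℝ) (hε : ε = 1 ∨ ε = -1) :
    ∃ (W : Set (Crd 4)) (c : ℝ) (P ψ Q : Crd 2 → ℝ) (A : ℝ → ℝ),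
      IsOpen W ∧ W.Nonempty ∧ IsModelData W Λ ε c P ψ Q A := by
  -- With `P = log u(t₁)` the Liouville equation becomes `u u'' - u'² = Λ`. Here `u'' = u`, and `u²
  -- - u'²` is four times the product of the coefficients `1` and `Λ/4`, that is, `Λ`.
  set u : ℝ → ℝ := fun s => Real.exp s + Λ / 4 * Real.exp (-s) with hu
  set u' : ℝ → ℝ := fun s => Real.exp s - Λ / 4 * Real.exp (-s) with hu'
  have hn : ∀ s, HasDerivAt (fun s : ℝ => Real.exp (-s)) (-Real.exp (-s)) s := fun s => by
    simpa using (hasDerivAt_neg s).exp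
  have hdu : ∀ s, HasDerivAt u (u' s) s := fun s => by
    have := (Real.hasDerivAt_exp s).add ((hn s).const_mul (Λ / 4))
    exact this.congr_deriv (by change _ = Real.exp s - Λ / 4 * Real.exp (-s); ring)
  have hdu' : ∀ s, HasDerivAt u' (u s) s := fun s => by
    have := (Real.hasDerivAt_exp s).sub ((hn s).const_mul (Λ / 4))
    exact this.congr_deriv (by change _ = Real.exp s + Λ / 4 * Real.exp (-s); ring)
  have huc : ContDiff ℝ ∞ u := by fun_prop
  let W : Set (Crd 4) := {x | 0 < u (x 0)}
  have hW : IsOpen W := by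
    refine isOpen_lt continuous_const (huc.continuous.comp ?_)
    exact (EuclideanSpace.proj 0 : Crd 4 →L[ℝ] ℝ).continuous
  have hT := isOpen_image_tPart hW
  have hpos : ∀ t ∈ tPart '' W, 0 < u (t 0) := by
    rintro _ ⟨x, hx, rfl⟩
    exact hx
  have hlog : ∀ s, 0 < u s → HasDerivAt (fun s => Real.log (u s)) (u' s / u s) s :=
    fun s hs => (hdu s).log hs.ne'
  have hquot : ∀ s, 0 < u s →
      HasDerivAt (fun s => u' s / u s) ((u s * u s - u' s * u' s) / u s ^ 2) s :=
    fun s hs => (hdu' s).div (hdu s) hs.ne'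
  let P : Crd 2 → ℝ := fun t => Real.log (u (t 0))
  have h0 : ContDiff ℝ ∞ (fun t : Crd 2 => t 0) :=
    (EuclideanSpace.proj 0 : Crd 2 →L[ℝ] ℝ).contDiff
  have h1 : ContDiff ℝ ∞ (fun t : Crd 2 => t 1) :=
    (EuclideanSpace.proj 1 : Crd 2 →L[ℝ] ℝ).contDiff
  have hP : ContDiffOn ℝ ∞ P (tPart '' W) :=
    (huc.comp h0).contDiffOn.log fun t ht => (hpos t ht).ne'
  have hP0 : ∀ t ∈ tPart '' W, pd 0 P t = u' (t 0) / u (t 0) := fun t ht => by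
    have := hlog _ (hpos t ht)
    simp only [P]
    rw [pd_comp_coord (A := fun s => Real.log (u s)) this.differentiableAt, this.deriv]; simp
  have hP1 : ∀ t ∈ tPart '' W, pd 1 P t = 0 := fun t ht => by
    have := hlog _ (hpos t ht)
    simp only [P]
    rw [pd_comp_coord (A := fun s => Real.log (u s)) this.differentiableAt]; simp
  have hexp : ∀ t ∈ tPart '' W, Real.exp (-2 * P t) = 1 / u (t 0) ^ 2 := fun t ht => by
    have : -2 * P t = -(P t + P t) := by ring
    rw [this, Real.exp_neg, Real.exp_add, Real.exp_log (hpos t ht), sq, one_div]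
  have hz : ∀ (i j : Fin 2) (t : Crd 2), pd i (pd j (fun _ : Crd 2 => (0 : ℝ))) t = 0 := by
    intro i j t
    have : pd j (fun _ : Crd 2 => (0 : ℝ)) = fun _ => 0 := funext fun t => pd_const 0
    rw [this, pd_const]
  -- With `ψ = 0` and `c = 1` the equation for `ψ` reduces to `1 + 2 ε A' = 0`, whence the slope
  -- `-ε/2` of `A`. As `P` does not depend on `t₂`, `t₂ e^{-2P}` is an antiderivative.
  refine ⟨W, 1, P, fun _ => 0, fun t => t 1 * Real.exp (-2 * P t), fun s => -ε / 2 * s, hW, ?_,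
    hε, one_ne_zero, hP, contDiffOn_const, h1.contDiffOn.mul ((contDiffOn_const.mul hP).exp),
    (contDiff_const.mul contDiff_id).contDiffOn, fun t ht => ?_, fun x _ => ?_, fun t ht => ?_⟩
  -- At `e^s = 1 + |Λ|` the first term of `u` dominates the possibly negative second one.
  · refine ⟨EuclideanSpace.single 0 (Real.log (1 + |Λ|)), ?_⟩
    have hΛ : 0 < 1 + |Λ| := by positivity
    have h4 : (1 + |Λ|)⁻¹ ≤ 1 := inv_le_one_of_one_le₀ (by linarith [abs_nonneg Λ])
    have h5 : 0 < (1 + |Λ|)⁻¹ := inv_pos.2 hΛ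
    simp only [W, hu, Set.mem_ofPred_eq, PiLp.single_apply, if_true, Real.exp_neg, Real.exp_log hΛ]
    nlinarith [neg_abs_le Λ, abs_nonneg Λ]
  · have hPd := differentiableAt_of_mem hT hP ht
    rw [pd_mul (h1.differentiable (by simp) t) ((hPd.const_mul _).exp), pd_exp_mul _ hPd,
      hP1 t ht, pd_coord]
    simp
  · have : deriv (fun s : ℝ => -ε / 2 * s) (x 2) = -ε / 2 := by
      simp
    rw [hz, hz, this]
    rcases hε with rfl | rfl <;> ring
  · have hq := hquot _ (hpos t ht)
    rw [pd_congr_of_eqOn hT ht hP0, pd_zero_of_eqOn hT ht hP1,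
      pd_comp_coord (A := fun s => u' s / u s) hq.differentiableAt, hq.deriv, hexp t ht]
    have : u (t 0) * u (t 0) - u' (t 0) * u' (t 0) = Λ := by
      simp only [hu, hu', Real.exp_neg]
      field_simp [(Real.exp_pos (t 0)).ne']
      ring
    rw [this]; simp [div_eq_mul_inv]

/-! ### Locality: metrics that agree on an open set -/

section Congruence

variable {n : ℕ} {W : Set (Crd n)} {G H : Crd n → Matrix (Fin n) (Fin n) ℝ}

theorem pd_entry_congr (hW : IsOpen W) (h : ∀ x ∈ W, G x = H x) {x : Crd n} (hx : x ∈ W)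
    (l i j : Fin n) : pd l (fun y => G y i j) x = pd l (fun y => H y i j) x :=
  pd_congr_of_eqOn hW hx fun y hy => by rw [h y hy]

theorem christoffel_congr (hW : IsOpen W) (h : ∀ x ∈ W, G x = H x) {x : Crd n} (hx : x ∈ W)
    (k i j : Fin n) : christoffel G k i j x = christoffel H k i j x := by
  simp only [christoffel, h x hx, pd_entry_congr hW h hx]

theorem ricci_congr (hW : IsOpen W) (h : ∀ x ∈ W, G x = H x) {x : Crd n} (hx : x ∈ W)
    (k j : Fin n) : ricci G k j x = ricci H k j x := by
  have hp : ∀ l k i j, pd l (christoffel G k i j) x = pd l (christoffel H k i j) x :=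
    fun l k i j => pd_congr_of_eqOn hW hx fun y hy => christoffel_congr hW h hy k i j
  simp only [ricci, riemann, hp, christoffel_congr hW h hx]

theorem lieMetric_congr (hW : IsOpen W) (h : ∀ x ∈ W, G x = H x) {x : Crd n} (hx : x ∈ W)
    (V : Crd n → Crd n) (i j : Fin n) : lieMetric G V i j x = lieMetric H V i j x := by
  simp only [lieMetric, h x hx, pd_entry_congr hW h hx]

theorem SolitonEquationOn.congr {V : Crd n → Crd n} {Λ : ℝ} (hs : SolitonEquationOn W G V Λ)
    (hW : IsOpen W) (h : ∀ x ∈ W, G x = H x) : SolitonEquationOn W H V Λ := fun x hx i j => by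
  rw [← ricci_congr hW h hx, ← lieMetric_congr hW h hx, ← h x hx]
  exact hs x hx i j

theorem fUp_congr {G H : Crd 4 → Matrix (Fin 4) (Fin 4) ℝ} {x y : Crd 4} (h : G x = H y) :
    fUp G x = fUp H y := by
  simp only [fUp, fMat, hMat, h]

theorem orbitMetric_congr {G H : Crd 4 → Matrix (Fin 4) (Fin 4) ℝ} {x : Crd 4} (h : G x = H x) :
    orbitMetric G x = orbitMetric H x := by
  simp only [orbitMetric, fMat, hMat, bMat, h]

theorem curvatureField_congr {W : Set (Crd 4)} {G H : Crd 4 → Matrix (Fin 4) (Fin 4) ℝ}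
    (hW : IsOpen W) (h : ∀ x ∈ W, G x = H x) {x : Crd 4} (hx : x ∈ W) :
    curvatureField G x = curvatureField H x := by
  have hp : ∀ l i j, pd l (fun y => fUp G y i j) x = pd l (fun y => fUp H y i j) x :=
    fun l i j => pd_congr_of_eqOn hW hx fun y hy => by rw [fUp_congr (h y hy)]
  funext k
  simp only [curvatureField, hp, orbitMetric_congr (h x hx)]

theorem AdaptedConditions.congr {W : Set (Crd 4)} {G H : Crd 4 → Matrix (Fin 4) (Fin 4) ℝ}
    {V : Crd 4 → Crd 4} (ha : AdaptedConditions W G V) (hW : IsOpen W)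
    (h : ∀ x ∈ W, G x = H x) : AdaptedConditions W H V := by
  have hh : ∀ x ∈ W, hMat H x = hMat G x := fun x hx => by simp only [hMat, h x hx]
  have horth : ∀ x ∈ W, ∀ v, IsOrthToLeaf G x v ↔ IsOrthToLeaf H x v := fun x hx v => by
    simp only [IsOrthToLeaf, h x hx]
  refine ⟨fun x hx => ?_, fun x hx => ?_, fun x hx => ?_, ha.tangent, ?_⟩
  · rw [hh x hx]; exact ha.leaves_nonnull x hx
  · rw [← curvatureField_congr hW h hx]; exact ha.intransitive x hx
  · rw [← curvatureField_congr hW h hx, hh x hx]; exact ha.curvature_null x hx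
  · intro O hO hOW Y hY hYo x hx
    exact (horth x (hOW hx) _).1 (ha.symmetry O hO hOW Y hY
      (fun y hy => (horth y (hOW hy) _).2 (hYo y hy)) x hx)

end Congruence

/-! ### Coordinate cubes: convex, and stable under replacing coordinates by those of the centre -/

section Box

variable {n : ℕ}

/-- The open coordinate cube of half side `r` about `x₀`. -/
def cube (x₀ : Crd n) (r : ℝ) : Set (Crd n) := {x | ∀ i, |x i - x₀ i| < r}

theorem isOpen_cube (x₀ : Crd n) (r : ℝ) : IsOpen (cube x₀ r) := by
  simp only [cube, Set.ofPred_forall]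
  refine isOpen_iInter_of_finite fun i => isOpen_lt (continuous_abs.comp ?_) continuous_const
  exact ((EuclideanSpace.proj i : Crd n →L[ℝ] ℝ).continuous).sub continuous_const

theorem mem_cube_self (x₀ : Crd n) {r : ℝ} (hr : 0 < r) : x₀ ∈ cube x₀ r := fun i => by simpa

theorem convex_cube (x₀ : Crd n) (r : ℝ) : Convex ℝ (cube x₀ r) := by
  intro x hx y hy a b ha hb hab i
  have h1 := abs_lt.1 (hx i)
  have h2 := abs_lt.1 (hy i)
  have e : (a • x + b • y) i - x₀ i = a * (x i - x₀ i) + b * (y i - x₀ i) := by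
    simp only [PiLp.add_apply, PiLp.smul_apply, smul_eq_mul]
    linear_combination x₀ i * hab
  rw [e, abs_lt]
  constructor
  · rcases ha.eq_or_lt with rfl | ha
    · simp at hab; subst hab; linarith
    · nlinarith
  · rcases ha.eq_or_lt with rfl | ha
    · simp at hab; subst hab; linarith
    · nlinarith

theorem exists_cube_subset {x₀ : Crd n} {N : Set (Crd n)} (hN : N ∈ nhds x₀) :
    ∃ r > 0, cube x₀ r ⊆ N := by
  have e := (EuclideanSpace.equiv (Fin n) ℝ).symm.continuous.tendsto
    ((EuclideanSpace.equiv (Fin n) ℝ) x₀)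
  rw [ContinuousLinearEquiv.symm_apply_apply] at e
  obtain ⟨r, hr, h⟩ := Metric.mem_nhds_iff.1 (e hN)
  refine ⟨r, hr, fun x hx => ?_⟩
  have : (EuclideanSpace.equiv (Fin n) ℝ) x ∈ Metric.ball ((EuclideanSpace.equiv (Fin n) ℝ) x₀) r := by
    rw [Metric.mem_ball, dist_pi_lt_iff hr]
    exact fun i => hx i
  simpa using h this

theorem fderiv_eq_sum_pd (F : Crd n → ℝ) (x v : Crd n) :
    fderiv ℝ F x v = ∑ i, v i * pd i F x := by
  have hv : v = ∑ i, v i • basisVec i := by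
    ext j
    simp [basisVec, Pi.single_apply]
  conv_lhs => rw [hv]
  simp [pd]

/-- By the mean value theorem on the segment from `y` to `x`, the difference of values is a
derivative in the direction `x - y`, which involves only the partial derivatives in the coordinates
where the two points differ. -/
theorem eq_of_pd_eq_zero {S : Set (Crd n)} (hc : Convex ℝ S) {F : Crd n → ℝ}
    (hF : ∀ z ∈ S, DifferentiableAt ℝ F z) {x y : Crd n} (hx : x ∈ S) (hy : y ∈ S)
    (h : ∀ z ∈ S, ∀ i, x i ≠ y i → pd i F z = 0) : F x = F y := by
  obtain ⟨z, hz, e⟩ := domain_mvt (f := F) (f' := fderiv ℝ F) (s := S)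
    (fun z hz => (hF z hz).hasFDerivAt.hasFDerivWithinAt) hc hy hx
  have hzS := hc.segment_subset hy hx hz
  rw [fderiv_eq_sum_pd, Finset.sum_eq_zero] at e
  · linarith
  · intro i _
    by_cases hi : x i = y i
    · simp [hi]
    · simp [h z hzS i hi]

end Box

/-! ### From the soliton equation to the model data -/

section Classification

variable {x₀ : Crd 4} {r Λ ε : ℝ} {P ψ f : Crd 2 → ℝ} {V : Crd 4 → Crd 4}

theorem pd_one_ne_zero_of_intransitive {W : Set (Crd 4)} (hs : SmoothCoeff W ε P ψ f)
    (ha : AdaptedConditions W (modelMetric ε 1 P ψ f) V) {x : Crd 4} (hx : x ∈ W) :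
    pd 1 f (tPart x) ≠ 0 := by
  intro h0
  refine ha.intransitive x hx (funext fun k => ?_)
  have hf := differentiableAt_of_mem (isOpen_image_tPart hs.isOpen) hs.Q_smooth
    (Set.mem_image_of_mem _ hx)
  fin_cases k <;> simp [curvatureField, fUp_modelMetric, pd_const, pd_one_comp_tPart hf, h0]

/-- The symmetry condition is tested on the frame `∂_{t₂}`, `∂_{t₁} - f ∂_{z₂}` of `Ξ^⊥`. Bracketing
these with a field tangent to the leaves gives vectors tangent to the leaves, and such a vector can
be orthogonal to the non-null leaf only if it vanishes. -/
theorem pd_coord_of_symmetry {W : Set (Crd 4)} (hs : SmoothCoeff W ε P ψ f)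
    (hV : ContDiffOn ℝ ∞ V W) (ha : AdaptedConditions W (modelMetric ε 1 P ψ f) V)
    {x : Crd 4} (hx : x ∈ W) {k : Fin 4} (hk : k = 2 ∨ k = 3) :
    pd 1 (fun y => V y k) x = 0 ∧
      pd 0 (fun y => V y k) x = f (tPart x) * pd 3 (fun y => V y k) x := by
  have hW := hs.isOpen
  have hVx : DifferentiableAt ℝ V x := (hV.contDiffAt (hW.mem_nhds hx)).differentiableAt (by simp)
  have hV0 : ∀ v, fderiv ℝ (fun y => V y 0) x v = 0 := fun v => by
    rw [(Filter.eventuallyEq_of_mem (hW.mem_nhds hx) (fun y hy => (ha.tangent y hy).1) :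
      (fun y => V y 0) =ᶠ[nhds x] fun _ => 0).fderiv_eq]
    simp
  have hVt : tPart (V x) = 0 := by
    ext i; fin_cases i
    · simpa using (ha.tangent x hx).1
    · simpa using (ha.tangent x hx).2
  have key : ∀ (B : Crd 4), IsOrthToLeaf (modelMetric ε 1 P ψ f) x B → B 0 = 0 → B k = 0 := by
    intro B hB h0
    have h2 : B 2 = 0 := by simpa [Fin.sum_univ_four, modelMetric] using hB.2
    have h3 : B 3 = 0 := by
      simpa [Fin.sum_univ_four, modelMetric, h0, h2] using hB.1
    rcases hk with rfl | rfl <;> assumption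
  constructor
  · have hb := ha.symmetry W hW le_rfl (fun _ => basisVec 1) contDiffOn_const
      (fun y _ => by constructor <;> simp [modelMetric, basisVec]) x hx
    have hc : ∀ j, VectorField.lieBracket ℝ V (fun _ => basisVec 1) x j
        = -pd 1 (fun y => V y j) x := fun j => by
      rw [lieBracket_coord hVx (differentiableAt_const _)]; simp [pd]
    have := key _ hb (by rw [hc, pd, hV0, neg_zero])
    rw [hc] at this
    linarith
  · let Y : Crd 4 → Crd 4 := fun y => !₂[1, 0, 0, -f (tPart y)]
    have hYs : ContDiffOn ℝ ∞ Y W := by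
      have := contDiffOn_comp_tPart hs.Q_smooth
      rw [contDiffOn_euclidean]
      intro i
      fin_cases i <;> simp [Y]
      · exact contDiffOn_const
      · exact contDiffOn_const
      · exact contDiffOn_const
      · exact this.neg
    have hYx : DifferentiableAt ℝ Y x :=
      (hYs.contDiffAt (hW.mem_nhds hx)).differentiableAt (by simp)
    have hb := ha.symmetry W hW le_rfl Y hYs
      (fun y _ => by constructor <;> simp [modelMetric, Y, Fin.sum_univ_four]) x hx
    have hY0 : ∀ j, fderiv ℝ (fun y => Y y j) x (V x) = 0 := by
      intro j
      have := fderiv_comp_tPart_eq_zero (u := f) (x := x) hVt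
      fin_cases j <;> simp [Y, this]
    have hc : ∀ j, VectorField.lieBracket ℝ V Y x j
        = -(pd 0 (fun y => V y j) x - f (tPart x) * pd 3 (fun y => V y j) x) := fun j => by
      rw [lieBracket_coord hVx hYx, hY0, fderiv_eq_sum_pd]
      simp [Fin.sum_univ_four, Y]
      ring
    have := key _ hb (by rw [hc, pd, pd, hV0, hV0]; simp)
    rw [hc] at this
    linarith

/-- Integrability condition: differentiating `∂_{t₁}Vᵏ = f ∂_{z₂}Vᵏ` in `t₂`, while `Vᵏ` does not
depend on `t₂`, leaves `f_{,t₂} ∂_{z₂}Vᵏ = 0`, and `f_{,t₂} ≠ 0` by orthogonal intransitivity. -/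
theorem pd_coord_eq_zero {W : Set (Crd 4)} (hs : SmoothCoeff W ε P ψ f)
    (hV : ContDiffOn ℝ ∞ V W) (ha : AdaptedConditions W (modelMetric ε 1 P ψ f) V)
    {x : Crd 4} (hx : x ∈ W) {k : Fin 4} (hk : k = 2 ∨ k = 3) {i : Fin 4} (hi : i ≠ 2) :
    pd i (fun y => V y k) x = 0 := by
  have hW := hs.isOpen
  have hVk : ContDiffOn ℝ ∞ (fun y => V y k) W := contDiffOn_euclidean.1 hV k
  have h1 : ∀ y ∈ W, pd 1 (fun y => V y k) y = 0 := fun y hy =>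
    (pd_coord_of_symmetry hs hV ha hy hk).1
  have h0 : ∀ y ∈ W, pd 0 (fun y => V y k) y = f (tPart y) * pd 3 (fun y => V y k) y :=
    fun y hy => (pd_coord_of_symmetry hs hV ha hy hk).2
  have hf := differentiableAt_of_mem (isOpen_image_tPart hW) hs.Q_smooth
    (Set.mem_image_of_mem _ hx)
  have h3 : pd 3 (fun y => V y k) x = 0 := by
    have e1 : pd 1 (pd 0 (fun y => V y k)) x = 0 := by
      rw [pd_comm hW hVk hx, pd_zero_of_eqOn hW hx h1]
    have hfd : DifferentiableAt ℝ (fun y => f (tPart y)) x := hf.comp x tPartL.differentiableAt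
    rw [pd_congr_of_eqOn hW hx h0, pd_mul hfd (differentiableAt_pd hW hVk hx), pd_comm hW hVk hx, pd_zero_of_eqOn hW hx h1] at e1
    rw [pd_one_comp_tPart hf] at e1
    simpa [pd_one_ne_zero_of_intransitive hs ha hx] using e1
  fin_cases i
  · exact (h0 x hx).trans (by rw [h3, mul_zero])
  · exact h1 x hx
  · exact absurd rfl hi
  · exact h3

/-- The metric enters with constant `1` and `Q = f`, since `c` is not known in advance: it appears
as the constant value of `e^{2P} f_{,t₂}`, and then `Q = f / c` is the antiderivative of `e^{-2P}`.
-/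
theorem exists_modelData_of_soliton (hr : 0 < r) (hs : SmoothCoeff (cube x₀ r) ε P ψ f)
    (hV : ContDiffOn ℝ ∞ V (cube x₀ r))
    (hsol : SolitonEquationOn (cube x₀ r) (modelMetric ε 1 P ψ f) V Λ)
    (ha : AdaptedConditions (cube x₀ r) (modelMetric ε 1 P ψ f) V) :
    ∃ (a c : ℝ) (A : ℝ → ℝ), IsModelData (cube x₀ r) Λ ε c P ψ (fun t => c⁻¹ * f t) A ∧
      ∀ x ∈ cube x₀ r, V x = modelField Λ a A x := by
  set S := cube x₀ r with hS
  have hSo : IsOpen S := isOpen_cube x₀ r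
  have hSc : Convex ℝ S := convex_cube x₀ r
  have hx₀ : x₀ ∈ S := mem_cube_self x₀ hr
  have hT := isOpen_image_tPart hSo
  have hVk : ∀ k, ContDiffOn ℝ ∞ (fun y => V y k) S := fun k => contDiffOn_euclidean.1 hV k
  have hVd : ∀ k, ∀ x ∈ S, DifferentiableAt ℝ (fun y => V y k) x := fun k x hx =>
    differentiableAt_of_mem hSo (hVk k) hx
  have hz : ∀ x ∈ S, ∀ k : Fin 4, k = 2 ∨ k = 3 → ∀ i : Fin 4, i ≠ 2 →
      pd i (fun y => V y k) x = 0 := fun x hx k hk i hi => pd_coord_eq_zero hs hV ha hx hk hi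
  have hE : ∀ x ∈ S, ∀ i j, modelRicci ε 1 P ψ f (tPart x) i j + 1 / 2 *
      leafLie 1 ψ f (pd 2 (fun y => V y 2) x) (pd 2 (fun y => V y 3) x) (tPart x) i j
        = Λ * modelMetric ε 1 P ψ f x i j := by
    intro x hx i j
    rw [← hs.ricci_eq hx, ← hsol x hx i j, lieMetric_modelMetric_eq (ha.tangent x hx).1
      (ha.tangent x hx).2 (fun l => pd_zero_of_eqOn hSo hx fun y hy => (ha.tangent y hy).1)
      (fun l => pd_zero_of_eqOn hSo hx fun y hy => (ha.tangent y hy).2)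
      (b := pd 2 (fun y => V y 2) x) (b' := pd 2 (fun y => V y 3) x)]
    · intro l
      split_ifs with hl
      · rw [hl]
      · exact hz x hx 2 (Or.inl rfl) l hl
    · intro l
      split_ifs with hl
      · rw [hl]
      · exact hz x hx 3 (Or.inr rfl) l hl
  -- The Ricci tensor has no `(z₁, z₂)` entry, so this entry of the soliton equation concerns the
  -- field alone.
  have hb : ∀ x ∈ S, pd 2 (fun y => V y 2) x = 2 * Λ := fun x hx => by
    have := hE x hx 2 3
    simp [modelRicci, leafLie, modelMetric] at this
    linarith
  have hd2 : ∀ x : Crd 4, DifferentiableAt ℝ (fun y : Crd 4 => y 2) x := fun x =>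
    (EuclideanSpace.proj 2 : Crd 4 →L[ℝ] ℝ).differentiableAt
  have hV2 : ∀ x ∈ S, V x 2 = 2 * Λ * x 2 + (V x₀ 2 - 2 * Λ * x₀ 2) := by
    intro x hx
    have := eq_of_pd_eq_zero hSc (F := fun y => V y 2 + -(2 * Λ) * y 2)
      (fun z hz => (hVd 2 z hz).add ((hd2 z).const_mul _)) hx hx₀ (fun z hzS i _ => by
        rw [pd_add (hVd 2 z hzS) ((hd2 z).const_mul _), pd_const_mul, pd_coord]
        by_cases hi : i = 2
        · subst hi; rw [hb z hzS]; simp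
        · rw [hz z hzS 2 (Or.inl rfl) i hi, if_neg (Ne.symm hi)]; simp)
    linarith
  -- The line through the centre in the direction `z₁`; it stays in the cube for the values of `z₁`
  -- taken there, so the function `A` can be read off along it.
  let ι : ℝ → Crd 4 := fun s => x₀ + (s - x₀ 2) • basisVec 2
  have hι : ContDiff ℝ ∞ ι := by fun_prop
  have hι2 : ∀ s, ι s 2 = s := fun s => by simp [ι, basisVec]
  have hιi : ∀ s i, i ≠ 2 → ι s i = x₀ i := fun s i hi => by simp [ι, basisVec, hi]
  have hιS : ∀ x ∈ S, ι (x 2) ∈ S := fun x hx i => by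
    by_cases hi : i = 2
    · subst hi; rw [hι2]; exact hx 2
    · rw [hιi _ _ hi]; simpa using hr
  let A : ℝ → ℝ := fun s => V (ι s) 3
  have hA : ContDiffOn ℝ ∞ A ((fun x : Crd 4 => x 2) '' S) :=
    (hVk 3).comp hι.contDiffOn (by rintro _ ⟨x, hx, rfl⟩; exact hιS x hx)
  have hV3 : ∀ x ∈ S, V x 3 = A (x 2) := fun x hx => by
    refine eq_of_pd_eq_zero hSc (F := fun y => V y 3) (hVd 3) hx (hιS x hx)
      fun z hzS i hi => hz z hzS 3 (Or.inr rfl) i ?_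
    rintro rfl
    exact hi (hι2 _).symm
  have hA' : ∀ x ∈ S, pd 2 (fun y => V y 3) x = deriv A (x 2) := fun x hx => by
    have hAd : DifferentiableAt ℝ A (x 2) :=
      (hA.contDiffAt ((isOpen_image_coord hSo 2).mem_nhds ⟨x, hx, rfl⟩)).differentiableAt (by simp)
    rw [pd_congr_of_eqOn hSo hx hV3, pd_comp_coord hAd]; simp
  have hPd : ∀ t ∈ tPart '' S, DifferentiableAt ℝ P t := fun t ht =>
    differentiableAt_of_mem hT hs.P_smooth ht
  have hf1 : ∀ t ∈ tPart '' S, DifferentiableAt ℝ (pd 1 f) t := fun t ht =>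
    differentiableAt_pd hT hs.Q_smooth ht
  -- Up to nonzero factors the Ricci entries `(t₁, z₁)` and `(t₂, z₁)` are `∂_{t₂}w` and `∂_{t₁}w`.
  -- The Lie derivative along the field already accounts for `Λ g` in these entries, so the soliton
  -- equation says that `w` is constant.
  let w : Crd 2 → ℝ := fun t => pd 1 f t * Real.exp (2 * P t)
  have hw : ∀ t ∈ tPart '' S, DifferentiableAt ℝ w t := fun t ht =>
    (hf1 t ht).mul ((hPd t ht).const_mul 2).exp
  have hε0 : ε ≠ 0 := by rcases hs.sign with rfl | rfl <;> norm_num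
  have hwc : ∀ x ∈ S, w (tPart x) = w (tPart x₀) := by
    intro x hx
    refine eq_of_pd_eq_zero hSc (F := fun y => w (tPart y))
      (fun z hz => (hw _ ⟨z, hz, rfl⟩).comp z tPartL.differentiableAt) hx hx₀ fun z hzS i _ => ?_
    have ht : tPart z ∈ tPart '' S := ⟨z, hzS, rfl⟩
    have e0 := hE z hzS 0 2
    have e1 := hE z hzS 1 2
    rw [hb z hzS] at e0 e1
    simp [modelRicci, leafLie, modelMetric] at e0 e1
    fin_cases i
    · change pd 0 (fun y => w (tPart y)) z = 0
      rw [pd_zero_comp_tPart (hw _ ht), pd_mul_exp (hf1 _ ht) (hPd _ ht)]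
      rw [e1, zero_mul]
    · change pd 1 (fun y => w (tPart y)) z = 0
      rw [pd_one_comp_tPart (hw _ ht), pd_mul_exp (hf1 _ ht) (hPd _ ht)]
      apply mul_left_cancel₀ hε0
      linear_combination (-2) * e0
    · exact pd_two_comp_tPart
    · exact pd_three_comp_tPart
  set c := w (tPart x₀) with hc
  have hc0 : c ≠ 0 := mul_ne_zero (pd_one_ne_zero_of_intransitive hs ha hx₀) (Real.exp_pos _).ne'
  have hf : ∀ t ∈ tPart '' S, pd 1 f t = c * Real.exp (-2 * P t) := by
    rintro _ ⟨x, hx, rfl⟩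
    rw [← hwc x hx]
    have := exp_neg_mul_exp (P (tPart x))
    rw [neg_mul]
    linear_combination (-pd 1 f (tPart x)) * this
  refine ⟨V x₀ 2 - 2 * Λ * x₀ 2, c, A, ⟨hs.sign, hc0, hs.P_smooth, hs.ψ_smooth,
    contDiffOn_const.mul hs.Q_smooth, hA, fun t ht => ?_, fun x hx => ?_, ?_⟩, fun x hx => ?_⟩
  · rw [pd_const_mul, hf t ht]; field_simp
  · have e := hE x hx 2 2
    rw [hb x hx, hA' x hx] at e
    simp [modelRicci, leafLie, modelMetric] at e
    have hwx : pd 1 f (tPart x) * Real.exp (2 * P (tPart x)) = c := hwc x hx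
    have he := exp_neg_mul_exp (P (tPart x))
    have hε2 : ε * ε = 1 := by rcases hs.sign with h | h <;> simp [h]
    rw [hwx] at e
    rw [neg_mul]
    linear_combination (-2 * Real.exp (-(2 * P (tPart x)))) * e - (pd 0 (pd 0 ψ) (tPart x) +
      ε * pd 1 (pd 1 ψ) (tPart x)) * he -
      2 * Real.exp (-(2 * P (tPart x))) * deriv A (x 2) * hε2
  · rintro _ ⟨x, hx, rfl⟩
    have e := hE x hx 0 0
    simp [modelRicci, leafLie, modelMetric] at e
    rw [neg_mul]
    exact e
  · ext i
    fin_cases i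
    · exact (ha.tangent x hx).1
    · exact (ha.tangent x hx).2
    · exact hV2 x hx
    · exact hV3 x hx

/-- The metric contains `c` and `Q` only through their product. -/
theorem modelMetric_rescale {c : ℝ} (hc : c ≠ 0) (x : Crd 4) :
    modelMetric ε c P ψ (fun t => c⁻¹ * f t) x = modelMetric ε 1 P ψ f x := by
  simp [modelMetric, hc]

end Classification

/-! ### Smooth cut-offs and primitives defined on the whole space -/

section Primitive

/-- Multiplication by a bump function. The changes of coordinates below are diffeomorphisms of the
whole of `ℝ⁴`, so functions known only near a point must first be made global. -/
theorem exists_contDiff_compactSupport_eventuallyEq {E : Type*} [NormedAddCommGroup E]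
    [NormedSpace ℝ E] [HasContDiffBump E] {f : E → ℝ} {N : Set E}
    (hN : IsOpen N) (hf : ContDiffOn ℝ ∞ f N) {x : E} (hx : x ∈ N) :
    ∃ (g : E → ℝ) (R : ℝ), ContDiff ℝ ∞ g ∧ (∀ y ∉ Metric.closedBall x R, g y = 0) ∧
      g =ᶠ[nhds x] f := by
  obtain ⟨R, hR, hRN⟩ := Metric.nhds_basis_closedBall.mem_iff.1 (hN.mem_nhds hx)
  let b : ContDiffBump x := ⟨R / 2, R, by positivity, by linarith⟩
  have hzero : ∀ y ∉ Metric.closedBall x R, b y = 0 := fun y hy => by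
    apply b.zero_of_le_dist
    simpa using (not_le.1 hy).le
  refine ⟨fun y => b y * f y, R, contDiff_iff_contDiffAt.2 fun y => ?_, fun y hy => ?_, ?_⟩
  · by_cases hy : y ∈ N
    · exact b.contDiffAt.mul (hf.contDiffAt (hN.mem_nhds hy))
    · have hy' : y ∈ (Metric.closedBall x R)ᶜ := fun h => hy (hRN h)
      refine (contDiffAt_const (c := (0 : ℝ))).congr_of_eventuallyEq ?_
      filter_upwards [Metric.isClosed_closedBall.isOpen_compl.mem_nhds hy'] with z hz
      rw [hzero z hz, zero_mul]
  · simp only [hzero y hy, zero_mul]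
  · filter_upwards [b.eventuallyEq_one] with y hy
    simp [hy]

theorem exists_contDiff_primitive {f : ℝ → ℝ} (hf : ContDiff ℝ ∞ f) :
    ∃ F : ℝ → ℝ, ContDiff ℝ ∞ F ∧ ∀ s, HasDerivAt F (f s) s := by
  have h : ∀ s, HasDerivAt (fun s => ∫ u in (0 : ℝ)..s, f u) (f s) s := fun s =>
    intervalIntegral.integral_hasDerivAt_right (hf.continuous.intervalIntegrable _ _)
      (hf.continuous.stronglyMeasurableAtFilter _ _) hf.continuous.continuousAt
  refine ⟨_, contDiff_infty_iff_deriv.2 ⟨fun s => (h s).differentiableAt, ?_⟩, h⟩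
  rwa [funext fun s => (h s).deriv]

theorem hasDerivAt_integral_Iic {k : ℝ → ℝ} (hk : Continuous k) (hi : MeasureTheory.Integrable k)
    (s : ℝ) : HasDerivAt (fun s => ∫ u in Set.Iic s, k u) (k s) s := by
  have e : (fun s => ∫ u in Set.Iic s, k u)
      = fun s => (∫ u in Set.Iic (0 : ℝ), k u) + ∫ u in (0 : ℝ)..s, k u := by
    funext s
    rw [← intervalIntegral.integral_Iic_sub_Iic hi.integrableOn hi.integrableOn]; ring
  rw [e]
  exact (intervalIntegral.integral_hasDerivAt_right (hk.intervalIntegrable _ _)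
    (hk.stronglyMeasurableAtFilter _ _) hk.continuousAt).const_add _

/-- After a cut-off, the primitive `∫_{-∞}^{t₂} g(t₁, u) du` is the convolution of `g(t₁, ·)` with
the Heaviside function. Joint smoothness in `(t₁, t₂)` then comes from smoothness of convolutions
with a parameter, for a locally integrable factor and a compactly supported smooth one. -/
theorem exists_contDiff_pd_one_eq {f : Crd 2 → ℝ} {N : Set (Crd 2)} (hN : IsOpen N)
    (hf : ContDiffOn ℝ ∞ f N) {t : Crd 2} (ht : t ∈ N) :
    ∃ V : Crd 2 → ℝ, ContDiff ℝ ∞ V ∧ ∀ᶠ s in nhds t, pd 1 V s = f s := by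
  obtain ⟨g, R, hg, hgz, hgf⟩ := exists_contDiff_compactSupport_eventuallyEq hN hf ht
  let k : ℝ → ℝ → ℝ := fun a b => g !₂[a, b]
  have hmk : ContDiff ℝ ∞ (fun q : ℝ × ℝ => (!₂[q.1, q.2] : Crd 2)) := by
    rw [contDiff_euclidean]
    intro i
    fin_cases i
    · exact contDiff_fst
    · exact contDiff_snd
  have hk : ContDiff ℝ ∞ (fun q : ℝ × ℝ => k q.1 q.2) := hg.comp hmk
  have hkz : ∀ a b, b ∉ Metric.closedBall (t 1) R → k a b = 0 := fun a b hb => by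
    apply hgz
    intro h
    apply hb
    rw [Metric.mem_closedBall, dist_eq_norm] at h ⊢
    exact (PiLp.norm_apply_le (!₂[a, b] - t) 1).trans h
  have hkc : ∀ a, Continuous (k a) := fun a =>
    hk.continuous.comp (by fun_prop : Continuous fun b : ℝ => (a, b))
  have hki : ∀ a, MeasureTheory.Integrable (k a) := fun a =>
    (hkc a).integrable_of_hasCompactSupport
      (HasCompactSupport.intro (isCompact_closedBall (t 1) R) (hkz a))
  let H : ℝ → ℝ := Set.indicator (Set.Ici 0) fun _ => 1
  have hH : MeasureTheory.LocallyIntegrable H :=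
    (MeasureTheory.locallyIntegrable_const (1 : ℝ)).indicator measurableSet_Ici
  have hconv := MeasureTheory.contDiffOn_convolution_right_with_param (n := ⊤) (ContinuousLinearMap.mul ℝ ℝ)
    (g := k) (s := Set.univ) isOpen_univ (isCompact_closedBall (t 1) R)
    (fun a b _ => hkz a b) hH hk.contDiffOn
  rw [Set.univ_prod_univ, contDiffOn_univ] at hconv
  have hval : ∀ a b, MeasureTheory.convolution H (k a) (ContinuousLinearMap.mul ℝ ℝ)
      MeasureTheory.volume b = ∫ u in Set.Iic b, k a u := fun a b => by
    rw [MeasureTheory.convolution_eq_swap, ← MeasureTheory.integral_indicator measurableSet_Iic]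
    congr 1
    funext u
    by_cases hu : u ≤ b <;> simp [H, Set.indicator, hu]
  let V : Crd 2 → ℝ := fun s => ∫ u in Set.Iic (s 1), k (s 0) u
  have hV : ContDiff ℝ ∞ V := by
    have h0 : ContDiff ℝ ∞ (fun s : Crd 2 => (s 0, s 1)) :=
      (EuclideanSpace.proj 0 : Crd 2 →L[ℝ] ℝ).contDiff.prodMk
        (EuclideanSpace.proj 1 : Crd 2 →L[ℝ] ℝ).contDiff
    have := hconv.comp h0
    convert this using 1
    funext s
    exact (hval _ _).symm
  refine ⟨V, hV, ?_⟩
  filter_upwards [hgf] with s hs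
  rw [← hs]
  have hd := (hV.differentiable (by simp) s).hasFDerivAt
  have hl : HasDerivAt (fun b : ℝ => s + (b - s 1) • (basisVec 1 : Crd 2)) (basisVec 1) (s 1) := by
    simpa using (((hasDerivAt_id (s 1)).sub_const (s 1)).smul_const (basisVec 1 : Crd 2)).const_add s
  have h1 := HasFDerivAt.comp_hasDerivAt_of_eq (s 1) hd hl (by simp)
  have h2 := hasDerivAt_integral_Iic (hkc (s 0)) (hki (s 0)) (s 1)
  have e : V ∘ (fun b : ℝ => s + (b - s 1) • (basisVec 1 : Crd 2))
      = fun b => ∫ u in Set.Iic b, k (s 0) u := by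
    funext b
    simp [V, basisVec]
  rw [e] at h1
  rw [pd, h1.unique h2]
  simp only [k]
  congr 1
  ext i; fin_cases i <;> simp

end Primitive

/-! ### Changes of chart and transformation of components -/

theorem bilin_apply_sum {ι E F : Type*} [Fintype ι] [AddCommGroup E] [Module ℝ E]
    [TopologicalSpace E] [AddCommGroup F] [Module ℝ F] [TopologicalSpace F]
    (b : LinearMap.BilinForm ℝ F) (L : E →L[ℝ] F) (u v : ι → ℝ) (w : ι → E) :
    b (L (∑ k, u k • w k)) (L (∑ l, v l • w l))
      = ∑ k, ∑ l, u k * v l * b (L (w k)) (L (w l)) := by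
  simp only [map_sum, map_smul, LinearMap.sum_apply, LinearMap.smul_apply, smul_eq_mul,
    Finset.mul_sum]
  rw [Finset.sum_comm]
  refine Finset.sum_congr rfl fun k _ => Finset.sum_congr rfl fun l _ => by ring

section ChartChange

variable {M : Type*} [TopologicalSpace M]
  {e : OpenPartialHomeomorph M (Crd 4)} {φ : Crd 4 ≃ₜ Crd 4} {B : Set (Crd 4)}

/-- The chart `φ ∘ e` with image restricted to the open set `B`. -/
def changeChart (e : OpenPartialHomeomorph M (Crd 4)) (φ : Crd 4 ≃ₜ Crd 4) (B : Set (Crd 4))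
    (hB : IsOpen B) : OpenPartialHomeomorph M (Crd 4) :=
  (e.trans φ.toOpenPartialHomeomorph).trans (OpenPartialHomeomorph.ofSet B hB)

theorem mem_changeChart_target (hB : IsOpen B) {x : Crd 4} :
    x ∈ (changeChart e φ B hB).target ↔ x ∈ B ∧ φ.symm x ∈ e.target := by
  simp [changeChart]

theorem mem_changeChart_source (hB : IsOpen B) {p : M} :
    p ∈ (changeChart e φ B hB).source ↔ p ∈ e.source ∧ φ (e p) ∈ B := by
  simp [changeChart]

variable [ChartedSpace (Crd 4) M]

theorem isInvertible_mfderiv_symm (he : e ∈ IsManifold.maximalAtlas (𝓡 4) ∞ M) {x : Crd 4}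
    (hx : x ∈ e.target) : (mfderiv (𝓡 4) (𝓡 4) e.symm x).IsInvertible := by
  have hmd : e.MDifferentiable (𝓡 4) (𝓡 4) :=
    ⟨(contMDiffOn_of_mem_maximalAtlas he).mdifferentiableOn (by simp),
      (contMDiffOn_symm_of_mem_maximalAtlas he).mdifferentiableOn (by simp)⟩
  exact ⟨hmd.symm.mfderiv hx, rfl⟩

theorem mdifferentiableAt_symm (he : e ∈ IsManifold.maximalAtlas (𝓡 4) ∞ M) {x : Crd 4}
    (hx : x ∈ e.target) : MDifferentiableAt (𝓡 4) (𝓡 4) e.symm x :=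
  (contMDiffAt_symm_of_mem_maximalAtlas he hx).mdifferentiableAt (by simp)

theorem changeChart_mem_maximalAtlas [IsManifold (𝓡 4) ∞ M] (hB : IsOpen B)
    (he : e ∈ IsManifold.maximalAtlas (𝓡 4) ∞ M) (hφ : ContDiff ℝ ∞ φ)
    (hφ' : ContDiff ℝ ∞ φ.symm) :
    changeChart e φ B hB ∈ IsManifold.maximalAtlas (𝓡 4) ∞ M := by
  apply OpenPartialHomeomorph.mem_maximalAtlas_of_contMDiffOn
  · exact (hφ.contMDiff.comp_contMDiffOn (contMDiffOn_of_mem_maximalAtlas he)).mono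
      fun p hp => ((mem_changeChart_source hB).1 hp).1
  · exact (contMDiffOn_symm_of_mem_maximalAtlas he).comp hφ'.contMDiff.contMDiffOn
      fun x hx => ((mem_changeChart_target hB).1 hx).2

theorem mfderiv_changeChart_symm (hB : IsOpen B) (he : e ∈ IsManifold.maximalAtlas (𝓡 4) ∞ M)
    (hφ' : ContDiff ℝ ∞ φ.symm) {x : Crd 4} (hx : φ.symm x ∈ e.target) :
    mfderiv (𝓡 4) (𝓡 4) (changeChart e φ B hB).symm x
      = (mfderiv (𝓡 4) (𝓡 4) e.symm (φ.symm x)).comp (fderiv ℝ φ.symm x) := by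
  have h1 : ((changeChart e φ B hB).symm : Crd 4 → M) = e.symm ∘ φ.symm := rfl
  rw [h1, mfderiv_comp (I' := 𝓡 4) x (mdifferentiableAt_symm he hx)
    ((hφ'.differentiable (by simp) x).mdifferentiableAt), mfderiv_eq_fderiv]
  rfl

theorem chartMetric_changeChart (hB : IsOpen B) (he : e ∈ IsManifold.maximalAtlas (𝓡 4) ∞ M)
    (hφ' : ContDiff ℝ ∞ φ.symm) (g : ∀ p : M, LinearMap.BilinForm ℝ (TangentSpace (𝓡 4) p))
    {x : Crd 4} (hx : φ.symm x ∈ e.target) (i j : Fin 4) :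
    chartMetric (changeChart e φ B hB) g x i j
      = ∑ k, ∑ l, pd i (fun y => φ.symm y k) x * pd j (fun y => φ.symm y l) x
          * chartMetric e g (φ.symm x) k l := by
  have hd := hφ'.differentiable (by simp) x
  have hv : ∀ i, fderiv ℝ φ.symm x (basisVec i)
      = ∑ k, pd i (fun y => φ.symm y k) x • (basisVec k : Crd 4) := fun i => by
    ext k
    rw [fderiv_coord hd]
    simp [basisVec, Pi.single_apply, pd]
  have hm : ∀ v : Crd 4, mfderiv (𝓡 4) (𝓡 4) (changeChart e φ B hB).symm x v
      = mfderiv (𝓡 4) (𝓡 4) e.symm (φ.symm x) (fderiv ℝ φ.symm x v) := fun v => by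
    rw [mfderiv_changeChart_symm hB he hφ' hx]; rfl
  have h0 : chartMetric (changeChart e φ B hB) g x i j
      = g (e.symm (φ.symm x))
        (mfderiv (𝓡 4) (𝓡 4) e.symm (φ.symm x) (fderiv ℝ φ.symm x (basisVec i)))
        (mfderiv (𝓡 4) (𝓡 4) e.symm (φ.symm x) (fderiv ℝ φ.symm x (basisVec j))) := by
    rw [← hm, ← hm]; rfl
  rw [h0, hv, hv]
  exact bilin_apply_sum (g (e.symm (φ.symm x))) (mfderiv (𝓡 4) (𝓡 4) e.symm (φ.symm x)) _ _ _

theorem chartField_changeChart (hB : IsOpen B) (he : e ∈ IsManifold.maximalAtlas (𝓡 4) ∞ M)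
    (hφ' : ContDiff ℝ ∞ φ.symm) (X : ∀ p : M, TangentSpace (𝓡 4) p)
    {x : Crd 4} (hx : φ.symm x ∈ e.target) {v : Crd 4} (hi : (fderiv ℝ φ.symm x).IsInvertible)
    (hv : fderiv ℝ φ.symm x v = chartField e X (φ.symm x)) :
    chartField (changeChart e φ B hB) X x = v := by
  have hinv := isInvertible_mfderiv_symm he hx
  have h1 : chartField (changeChart e φ B hB) X x
      = ((mfderiv (𝓡 4) (𝓡 4) e.symm (φ.symm x)).comp (fderiv ℝ φ.symm x)).inverse
        (X (e.symm (φ.symm x))) := by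
    rw [← mfderiv_changeChart_symm hB he hφ' hx]; rfl
  rw [h1, hinv.inverse_comp_apply_of_left]
  exact (hi.inverse_apply_eq).2 hv.symm

theorem contDiffOn_chartField [IsManifold (𝓡 4) ∞ M] (he : e ∈ IsManifold.maximalAtlas (𝓡 4) ∞ M)
    {X : ∀ p : M, TangentSpace (𝓡 4) p}
    (hX : ContMDiff (𝓡 4) (𝓡 4).tangent ∞ (fun p => (X p : TangentBundle (𝓡 4) M))) :
    ContDiffOn ℝ ∞ (chartField e X) e.target := by
  refine (contMDiffOn_vectorSpace_iff_contDiffOn (𝕜 := ℝ) (E := Crd 4) (V := chartField e X)).1 ?_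
  intro x hx
  exact (ContMDiffAt.mpullback_vectorField_preimage (n := ∞) (hX _)
    (contMDiffAt_symm_of_mem_maximalAtlas he hx) (isInvertible_mfderiv_symm he hx)
    (by simp)).contMDiffWithinAt

end ChartChange

/-! ### Algebra of the normal form -/

section NormalMatrix

/-- The matrix of `E (dt₁² + ε dt₂²) + a (dz₁ + f₁ dt₁)² + 2 h (dz₁ + f₁ dt₁)(dz₂ + f₂ dt₁)`. -/
def normalMatrix (ε E f₁ f₂ a h : ℝ) : Matrix (Fin 4) (Fin 4) ℝ :=
  !![E + a * f₁ ^ 2 + 2 * h * f₁ * f₂, 0, a * f₁ + h * f₂, h * f₁;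
     0, ε * E, 0, 0;
     a * f₁ + h * f₂, 0, a, h;
     h * f₁, 0, h, 0]

variable {ε E f₁ f₂ a h : ℝ} {G : Crd 4 → Matrix (Fin 4) (Fin 4) ℝ} {x : Crd 4}

theorem fUp_of_normalMatrix (hG : G x = normalMatrix ε E f₁ f₂ a h) (hh : h ≠ 0) :
    fUp G x = !![f₁, f₂; 0, 0] := by
  have hi : (hMat G x)⁻¹ = !![0, h⁻¹; h⁻¹, -a * h⁻¹ * h⁻¹] := by
    apply Matrix.inv_eq_right_inv
    ext i j
    fin_cases i <;> fin_cases j <;> simp [hMat, hG, normalMatrix, hh]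
    field_simp
    ring
  rw [fUp, hi]
  ext i j
  fin_cases i <;> fin_cases j <;> simp [fMat, hG, normalMatrix] <;> field_simp
  ring

theorem orbitMetric_of_normalMatrix (hG : G x = normalMatrix ε E f₁ f₂ a h) (hh : h ≠ 0) :
    orbitMetric G x = !![E, 0; 0, ε * E] := by
  have hu := fUp_of_normalMatrix hG hh
  rw [fUp] at hu
  rw [orbitMetric, hu]
  ext i j
  fin_cases i <;> fin_cases j <;>
    simp [fMat, bMat, hG, normalMatrix, Matrix.vecMul, Matrix.vecHead, Matrix.vecTail]
  ring

/-- The metric is recovered from its invariants: `f_{jk} = fⱼˢ h_{sk}` and `b = g̃ + f h⁻¹ fᵀ`. -/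
theorem eq_normalMatrix (hsymm : (G x).IsSymm) (hdet : (hMat G x).det ≠ 0) (h33 : G x 3 3 = 0)
    (hu0 : fUp G x 1 0 = 0) (hu1 : fUp G x 1 1 = 0)
    (horb : orbitMetric G x = !![E, 0; 0, ε * E]) :
    G x = normalMatrix ε E (fUp G x 0 0) (fUp G x 0 1) (G x 2 2) (G x 2 3) := by
  have hs : ∀ i j, G x j i = G x i j := fun i j => hsymm.apply i j
  have hf : fUp G x * hMat G x = fMat G x := by
    rw [fUp, Matrix.nonsing_inv_mul_cancel_right _ _ (isUnit_iff_ne_zero.2 hdet)]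
  have f02 := congrFun (congrFun hf 0) 0
  have f03 := congrFun (congrFun hf 0) 1
  have f12 := congrFun (congrFun hf 1) 0
  have f13 := congrFun (congrFun hf 1) 1
  have ho : bMat G x - fUp G x * (fMat G x).transpose = !![E, 0; 0, ε * E] := horb
  have b00 := congrFun (congrFun ho 0) 0
  have b01 := congrFun (congrFun ho 0) 1
  have b11 := congrFun (congrFun ho 1) 1
  simp [Matrix.mul_apply, hMat, fMat, bMat, hu0, hu1, h33, hs 2 3]
    at f02 f03 f12 f13 b00 b01 b11
  rw [← f12, ← f13] at b01
  simp at b01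
  ext i j
  fin_cases i <;> fin_cases j <;>
    simp [normalMatrix, h33, b01, b11, ← f12, ← f13, hs 2 3, hs 0 1, hs 0 2, hs 0 3, hs 1 2,
      hs 1 3]
  all_goals first
    | (rw [← f02, ← f03] at b00; linear_combination b00)
    | linear_combination -f02
    | linear_combination -f03

/-- The substitution is `dt₁ = α ds₁ - ε β ds₂`, `dt₂ = β ds₁ + α ds₂`, `dz₁ = dw₁ - dU`, `dz₂ = μ
(dw₂ - dV)`. The hypotheses on `u` say `dU = f₁ dt₁`, so `dz₁ + f₁ dt₁` becomes `dw₁`; those on `v`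
remove the `ds₂` part of `dz₂ + f₂ dt₁` and leave `μ (dw₂ + f₂' ds₁)`. -/
theorem normalMatrix_transform {α β μ f₂' u₀ u₁ v₀ v₁ : ℝ}
    (hu₀ : u₀ = α * f₁) (hu₁ : u₁ = -(ε * β * f₁)) (hv₀ : μ * v₀ = α * f₂ - μ * f₂')
    (hv₁ : μ * v₁ = -(ε * β * f₂)) (i j : Fin 4) :
    ∑ k, ∑ l, (!![α, -(ε * β), 0, 0; β, α, 0, 0; -u₀, -u₁, 1, 0; -(μ * v₀), -(μ * v₁), 0, μ] :
          Matrix (Fin 4) (Fin 4) ℝ) k i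
        * (!![α, -(ε * β), 0, 0; β, α, 0, 0; -u₀, -u₁, 1, 0; -(μ * v₀), -(μ * v₁), 0, μ] :
          Matrix (Fin 4) (Fin 4) ℝ) l j
        * normalMatrix ε E f₁ f₂ a h k l
      = normalMatrix ε ((α ^ 2 + ε * β ^ 2) * E) 0 f₂' a (μ * h) i j := by
  rw [hu₀, hu₁, hv₀, hv₁]
  fin_cases i <;> fin_cases j <;> simp [Fin.sum_univ_four, normalMatrix] <;> ring1

end NormalMatrix

/-! ### Conformal linear changes of the base combined with shifts along the leaves -/

section Gauge

/-- The homeomorphism whose inverse is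
`(s₁, s₂, w₁, w₂) ↦ (α s₁ - ε β s₂, β s₁ + α s₂, w₁ - U(s), μ (w₂ - V(s)))`. -/
def gaugeHomeo (α β ε μ : ℝ) (hD : α ^ 2 + ε * β ^ 2 ≠ 0) (hμ : μ ≠ 0) (U V : Crd 2 → ℝ)
    (hU : Continuous U) (hV : Continuous V) : Crd 4 ≃ₜ Crd 4 where
  toFun y := !₂[(α * y 0 + ε * β * y 1) / (α ^ 2 + ε * β ^ 2),
    (α * y 1 - β * y 0) / (α ^ 2 + ε * β ^ 2),
    y 2 + U !₂[(α * y 0 + ε * β * y 1) / (α ^ 2 + ε * β ^ 2),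
      (α * y 1 - β * y 0) / (α ^ 2 + ε * β ^ 2)],
    μ⁻¹ * y 3 + V !₂[(α * y 0 + ε * β * y 1) / (α ^ 2 + ε * β ^ 2),
      (α * y 1 - β * y 0) / (α ^ 2 + ε * β ^ 2)]]
  invFun x := !₂[α * x 0 - ε * β * x 1, β * x 0 + α * x 1, x 2 - U (tPart x),
    μ * (x 3 - V (tPart x))]
  left_inv y := by
    have h0 : α * ((α * y 0 + ε * β * y 1) / (α ^ 2 + ε * β ^ 2))
        - ε * β * ((α * y 1 - β * y 0) / (α ^ 2 + ε * β ^ 2)) = y 0 := by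
      rw [mul_div_assoc', mul_div_assoc', ← sub_div, div_eq_iff hD]; ring
    have h1 : β * ((α * y 0 + ε * β * y 1) / (α ^ 2 + ε * β ^ 2))
        + α * ((α * y 1 - β * y 0) / (α ^ 2 + ε * β ^ 2)) = y 1 := by
      rw [mul_div_assoc', mul_div_assoc', ← add_div, div_eq_iff hD]; ring
    ext i
    fin_cases i <;> simp [tPart, hμ, h0, h1]
  right_inv x := by
    have h0 : (α * (α * x 0 - ε * β * x 1) + ε * β * (β * x 0 + α * x 1)) / (α ^ 2 + ε * β ^ 2)
        = x 0 := by rw [div_eq_iff hD]; ring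
    have h1 : (α * (β * x 0 + α * x 1) - β * (α * x 0 - ε * β * x 1)) / (α ^ 2 + ε * β ^ 2)
        = x 1 := by rw [div_eq_iff hD]; ring
    have h2 : (!₂[x 0, x 1] : Crd 2) = tPart x := rfl
    ext i
    fin_cases i <;> simp [h0, h1, h2, hμ]
  continuous_toFun := by fun_prop
  continuous_invFun := by
    have : Continuous tPart := contDiff_tPart.continuous
    fun_prop

variable {α β ε μ : ℝ} {hD : α ^ 2 + ε * β ^ 2 ≠ 0} {hμ : μ ≠ 0} {U V : Crd 2 → ℝ}
  {hU : Continuous U} {hV : Continuous V}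

theorem gaugeHomeo_symm_apply (x : Crd 4) :
    (gaugeHomeo α β ε μ hD hμ U V hU hV).symm x
      = !₂[α * x 0 - ε * β * x 1, β * x 0 + α * x 1, x 2 - U (tPart x),
          μ * (x 3 - V (tPart x))] := rfl

theorem contDiff_coord {n : ℕ} (k : Fin n) : ContDiff ℝ ∞ (fun x : Crd n => x k) :=
  (EuclideanSpace.proj k : Crd n →L[ℝ] ℝ).contDiff

theorem contDiff_gaugeHomeo (hUs : ContDiff ℝ ∞ U) (hVs : ContDiff ℝ ∞ V) :
    ContDiff ℝ ∞ (gaugeHomeo α β ε μ hD hμ U V hU hV) := by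
  have h0 := contDiff_coord (n := 4) 0
  have h1 := contDiff_coord (n := 4) 1
  have h2 := contDiff_coord (n := 4) 2
  have h3 := contDiff_coord (n := 4) 3
  have a0 : ContDiff ℝ ∞ fun y : Crd 4 => (α * y 0 + ε * β * y 1) / (α ^ 2 + ε * β ^ 2) :=
    ((contDiff_const.mul h0).add (contDiff_const.mul h1)).div_const _
  have a1 : ContDiff ℝ ∞ fun y : Crd 4 => (α * y 1 - β * y 0) / (α ^ 2 + ε * β ^ 2) :=
    ((contDiff_const.mul h1).sub (contDiff_const.mul h0)).div_const _
  have a2 : ContDiff ℝ ∞ fun y : Crd 4 =>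
      (!₂[(α * y 0 + ε * β * y 1) / (α ^ 2 + ε * β ^ 2),
        (α * y 1 - β * y 0) / (α ^ 2 + ε * β ^ 2)] : Crd 2) := by
    rw [contDiff_euclidean]
    intro i
    fin_cases i
    · exact a0
    · exact a1
  rw [contDiff_euclidean]
  intro i
  fin_cases i
  · exact a0
  · exact a1
  · exact h2.add (hUs.comp a2)
  · exact (contDiff_const.mul h3).add (hVs.comp a2)

theorem contDiff_gaugeHomeo_symm (hUs : ContDiff ℝ ∞ U) (hVs : ContDiff ℝ ∞ V) :
    ContDiff ℝ ∞ (gaugeHomeo α β ε μ hD hμ U V hU hV).symm := by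
  have h0 := contDiff_coord (n := 4) 0
  have h1 := contDiff_coord (n := 4) 1
  have h2 := contDiff_coord (n := 4) 2
  have h3 := contDiff_coord (n := 4) 3
  rw [contDiff_euclidean]
  intro i
  fin_cases i
  · exact (contDiff_const.mul h0).sub (contDiff_const.mul h1)
  · exact (contDiff_const.mul h0).add (contDiff_const.mul h1)
  · exact h2.sub (hUs.comp contDiff_tPart)
  · exact contDiff_const.mul (h3.sub (hVs.comp contDiff_tPart))

theorem pd_sub {n : ℕ} {F H : Crd n → ℝ} {x : Crd n} {i : Fin n} (hF : DifferentiableAt ℝ F x)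
    (hH : DifferentiableAt ℝ H x) :
    pd i (fun y => F y - H y) x = pd i F x - pd i H x := by
  simp [pd, fderiv_fun_sub hF hH]

theorem pd_comp_tPart {u : Crd 2 → ℝ} {x : Crd 4} (hu : DifferentiableAt ℝ u (tPart x))
    (i : Fin 4) :
    pd i (fun y => u (tPart y)) x = ![pd 0 u (tPart x), pd 1 u (tPart x), 0, 0] i := by
  fin_cases i
  · exact pd_zero_comp_tPart hu
  · exact pd_one_comp_tPart hu
  · exact pd_two_comp_tPart
  · exact pd_three_comp_tPart

theorem pd_gaugeHomeo_symm (hUs : ContDiff ℝ ∞ U) (hVs : ContDiff ℝ ∞ V) (x : Crd 4)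
    (k i : Fin 4) :
    pd i (fun y => (gaugeHomeo α β ε μ hD hμ U V hU hV).symm y k) x
      = (!![α, -(ε * β), 0, 0; β, α, 0, 0; -pd 0 U (tPart x), -pd 1 U (tPart x), 1, 0;
          -(μ * pd 0 V (tPart x)), -(μ * pd 1 V (tPart x)), 0, μ] :
            Matrix (Fin 4) (Fin 4) ℝ) k i := by
  have hd : ∀ k : Fin 4, DifferentiableAt ℝ (fun x : Crd 4 => x k) x := fun k =>
    (contDiff_coord k).differentiable (by simp) x
  have hUd := hUs.differentiable (by simp) (tPart x)
  have hVd := hVs.differentiable (by simp) (tPart x)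
  have hUt : DifferentiableAt ℝ (fun y => U (tPart y)) x := hUd.comp x tPartL.differentiableAt
  have hVt : DifferentiableAt ℝ (fun y => V (tPart y)) x := hVd.comp x tPartL.differentiableAt
  simp only [gaugeHomeo_symm_apply]
  fin_cases k <;> simp only [Fin.zero_eta, Fin.mk_one, Fin.reduceFinMk]
  · change pd i (fun y => α * y 0 - ε * β * y 1) x = _
    rw [pd_sub ((hd 0).const_mul _) ((hd 1).const_mul _), pd_const_mul, pd_const_mul, pd_coord,
      pd_coord]
    fin_cases i <;> simp
  · change pd i (fun y => β * y 0 + α * y 1) x = _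
    rw [pd_add ((hd 0).const_mul _) ((hd 1).const_mul _), pd_const_mul, pd_const_mul, pd_coord,
      pd_coord]
    fin_cases i <;> simp
  · change pd i (fun y => y 2 - U (tPart y)) x = _
    rw [pd_sub (hd 2) hUt, pd_coord, pd_comp_tPart hUd]
    fin_cases i <;> simp
  · change pd i (fun y => μ * (y 3 - V (tPart y))) x = _
    rw [pd_const_mul, pd_sub (hd 3) hVt, pd_coord, pd_comp_tPart hVd]
    fin_cases i <;> simp

theorem isInvertible_fderiv_homeo_symm {φ : Crd 4 ≃ₜ Crd 4} (hφ : ContDiff ℝ ∞ φ)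
    (hφ' : ContDiff ℝ ∞ φ.symm) (x : Crd 4) : (fderiv ℝ φ.symm x).IsInvertible := by
  have h1 : HasFDerivAt φ.symm (fderiv ℝ φ.symm x) x :=
    (hφ'.differentiable (by simp) x).hasFDerivAt
  have h2 : HasFDerivAt φ (fderiv ℝ φ (φ.symm x)) (φ.symm x) :=
    (hφ.differentiable (by simp) _).hasFDerivAt
  have e1 : (fderiv ℝ φ (φ.symm x)).comp (fderiv ℝ φ.symm x) = ContinuousLinearMap.id ℝ _ := by
    have h3 := h2.comp x h1
    have : (φ ∘ φ.symm : Crd 4 → Crd 4) = id := by funext y; simp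
    rw [this] at h3
    exact h3.unique (hasFDerivAt_id x)
  have e2 : (fderiv ℝ φ.symm x).comp (fderiv ℝ φ (φ.symm x)) = ContinuousLinearMap.id ℝ _ := by
    have h1' : HasFDerivAt φ.symm (fderiv ℝ φ.symm x) (φ (φ.symm x)) := by simpa using h1
    have h3 := h1'.comp (φ.symm x) h2
    have : (φ.symm ∘ φ : Crd 4 → Crd 4) = id := by funext y; simp
    rw [this] at h3
    exact h3.unique (hasFDerivAt_id _)
  exact ⟨ContinuousLinearEquiv.equivOfInverse _ _ (fun v => DFunLike.congr_fun e1 v)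
    (fun v => DFunLike.congr_fun e2 v), rfl⟩

theorem pd_comp {F : Crd 4 → ℝ} {Φ : Crd 4 → Crd 4} {x : Crd 4}
    (hF : DifferentiableAt ℝ F (Φ x)) (hΦ : DifferentiableAt ℝ Φ x) (i : Fin 4) :
    pd i (fun y => F (Φ y)) x = ∑ k, pd i (fun y => Φ y k) x * pd k F (Φ x) := by
  have h : HasFDerivAt (fun y => F (Φ y)) ((fderiv ℝ F (Φ x)).comp (fderiv ℝ Φ x)) x :=
    hF.hasFDerivAt.comp x hΦ.hasFDerivAt
  rw [pd, h.fderiv, ContinuousLinearMap.comp_apply, fderiv_eq_sum_pd]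
  simp only [fderiv_coord hΦ]
  rfl

end Gauge

/-! ### Adapted charts and the change to a new normal chart -/

section Charts

variable {M : Type*} [TopologicalSpace M] [ChartedSpace (Crd 4) M] [IsManifold (𝓡 4) ∞ M]
  {g : ∀ p : M, LinearMap.BilinForm ℝ (TangentSpace (𝓡 4) p)}
  {𝒢 : Submodule ℝ (∀ p : M, TangentSpace (𝓡 4) p)}
  {X : ∀ p : M, TangentSpace (𝓡 4) p} {Λ : ℝ} {p : M} {e : OpenPartialHomeomorph M (Crd 4)}

theorem StandingHypotheses.chartMetric_isSymm (h : StandingHypotheses g 𝒢 X Λ) (x : Crd 4) :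
    (chartMetric e g x).IsSymm := by
  ext i j
  exact (h.metric_symm (e.symm x)).eq _ _

theorem pd_eq_zero_of_killing_basisVec {W : Set (Crd 4)} (hW : IsOpen W)
    {G : Crd 4 → Matrix (Fin 4) (Fin 4) ℝ} {V : Crd 4 → Crd 4} {k : Fin 4}
    (hV : ∀ x ∈ W, V x = basisVec k) (hK : IsKillingOn W G V) {x : Crd 4} (hx : x ∈ W)
    (i j : Fin 4) : pd k (fun y => G y i j) x = 0 := by
  have hc : ∀ a l : Fin 4, pd l (fun y => V y a) x = 0 := fun a l =>
    pd_zero_of_eqOn hW hx (c := (basisVec k : Crd 4) a) fun y hy => by rw [hV y hy]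
  have := hK x hx i j
  simp only [lieMetric, hc, hV x hx, mul_zero, add_zero] at this
  simpa [basisVec, Pi.single_apply] using this

theorem StandingHypotheses.pd_chartMetric (h : StandingHypotheses g 𝒢 X Λ)
    (he : IsAdaptedChart 𝒢 e) {x : Crd 4} (hx : x ∈ e.target) {k : Fin 4} (hk : k = 2 ∨ k = 3)
    (i j : Fin 4) : pd k (fun y => chartMetric e g y i j) x = 0 := by
  rcases hk with rfl | rfl
  · obtain ⟨ξ, hξ, hb⟩ := he.dz₁
    exact pd_eq_zero_of_killing_basisVec e.open_target hb (h.killing ξ hξ e he.smooth) hx i j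
  · obtain ⟨ξ, hξ, hb⟩ := he.dz₂
    exact pd_eq_zero_of_killing_basisVec e.open_target hb (h.killing ξ hξ e he.smooth) hx i j

/-- Infinitesimal invariance along `z₁, z₂` integrates only over a convex set: the fibres of a chart
domain over `(t₁, t₂)` may be disconnected. -/
theorem StandingHypotheses.chartMetric_eq (h : StandingHypotheses g 𝒢 X Λ)
    (he : IsAdaptedChart 𝒢 e) {S : Set (Crd 4)} (hSc : Convex ℝ S)
    (hS : S ⊆ e.target) {x y : Crd 4} (hx : x ∈ S) (hy : y ∈ S) (h0 : x 0 = y 0)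
    (h1 : x 1 = y 1) : chartMetric e g x = chartMetric e g y := by
  ext i j
  refine eq_of_pd_eq_zero hSc (F := fun y => chartMetric e g y i j)
    (fun z hz => differentiableAt_of_mem e.open_target (h.metric_smooth e he.smooth i j) (hS hz))
    hx hy fun z hz k hk => h.pd_chartMetric he (hS hz) ?_ i j
  fin_cases k
  · exact absurd h0 hk
  · exact absurd h1 hk
  · exact Or.inl rfl
  · exact Or.inr rfl

theorem StandingHypotheses.chartMetric_two_three_ne (h : StandingHypotheses g 𝒢 X Λ)
    (he : IsAdaptedChart 𝒢 e) {ε : ℝ} (hN : IsNormalForm e.target (chartMetric e g) ε) {x : Crd 4}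
    (hx : x ∈ e.target) : chartMetric e g x 2 3 ≠ 0 := by
  intro h0
  apply (h.adapted e he).leaves_nonnull x hx
  have h1 : chartMetric e g x 3 2 = chartMetric e g x 2 3 := (h.chartMetric_isSymm x).apply 2 3
  simp [hMat, Matrix.det_fin_two, hN.null x hx, h1, h0]

theorem StandingHypotheses.eq_normalMatrix (h : StandingHypotheses g 𝒢 X Λ)
    (he : IsAdaptedChart 𝒢 e) {ε : ℝ} (hN : IsNormalForm e.target (chartMetric e g) ε) {x : Crd 4}
    (hx : x ∈ e.target) : ∃ E > 0, chartMetric e g x = normalMatrix ε E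
      (fUp (chartMetric e g) x 0 0) (fUp (chartMetric e g) x 0 1)
      (chartMetric e g x 2 2) (chartMetric e g x 2 3) := by
  obtain ⟨P, hP⟩ := hN.orbit
  exact ⟨_, Real.exp_pos _, RicciSoliton.eq_normalMatrix (h.chartMetric_isSymm x)
    ((h.adapted e he).leaves_nonnull x hx) (hN.null x hx) (hN.gauge x hx).1 (hN.gauge x hx).2
    (hP x hx)⟩

/-- In normal form `f₁¹` is the quotient of the components `(t₁, z₂)` and `(z₁, z₂)` of the metric.
-/
theorem StandingHypotheses.contDiffOn_fUp_zero (h : StandingHypotheses g 𝒢 X Λ)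
    (he : IsAdaptedChart 𝒢 e) {ε : ℝ} (hN : IsNormalForm e.target (chartMetric e g) ε) :
    ContDiffOn ℝ ∞ (fun x => fUp (chartMetric e g) x 0 0) e.target := by
  have hs := fun i j => h.metric_smooth e he.smooth i j
  refine ((hs 0 3).div (hs 2 3) fun x hx => h.chartMetric_two_three_ne he hN hx).congr
    fun x hx => ?_
  obtain ⟨E, -, hE⟩ := h.eq_normalMatrix he hN hx
  have h3 := congrFun (congrFun hE 0) 3
  simp [normalMatrix] at h3
  rw [Pi.div_apply, eq_div_iff (h.chartMetric_two_three_ne he hN hx), h3, mul_comm]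

theorem StandingHypotheses.contDiffOn_fUp_one (h : StandingHypotheses g 𝒢 X Λ)
    (he : IsAdaptedChart 𝒢 e) {ε : ℝ} (hN : IsNormalForm e.target (chartMetric e g) ε) :
    ContDiffOn ℝ ∞ (fun x => fUp (chartMetric e g) x 0 1) e.target := by
  have hs := fun i j => h.metric_smooth e he.smooth i j
  refine (((hs 0 2).sub ((hs 2 2).mul (h.contDiffOn_fUp_zero he hN))).div (hs 2 3)
    fun x hx => h.chartMetric_two_three_ne he hN hx).congr fun x hx => ?_
  obtain ⟨E, -, hE⟩ := h.eq_normalMatrix he hN hx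
  have h3 := congrFun (congrFun hE 0) 2
  simp [normalMatrix] at h3
  refine (eq_div_iff (h.chartMetric_two_three_ne he hN hx)).2 ?_
  change _ = chartMetric e g x 0 2 - chartMetric e g x 2 2 * fUp (chartMetric e g) x 0 0
  linear_combination -h3

theorem isAdaptedChart_changeChart (he : IsAdaptedChart 𝒢 e) {α β ε μ : ℝ}
    {hD : α ^ 2 + ε * β ^ 2 ≠ 0} {hμ : μ ≠ 0} {U V : Crd 2 → ℝ} (hU : ContDiff ℝ ∞ U)
    (hV : ContDiff ℝ ∞ V) {B : Set (Crd 4)} (hB : IsOpen B) :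
    IsAdaptedChart 𝒢 (changeChart e (gaugeHomeo α β ε μ hD hμ U V hU.continuous hV.continuous)
      B hB) := by
  set φ := gaugeHomeo α β ε μ hD hμ U V hU.continuous hV.continuous with hφdef
  have hφ : ContDiff ℝ ∞ φ := contDiff_gaugeHomeo hU hV
  have hφ' : ContDiff ℝ ∞ φ.symm := contDiff_gaugeHomeo_symm hU hV
  have hcol : ∀ x (i k : Fin 4), (fderiv ℝ φ.symm x (basisVec i)) k
      = pd i (fun y => φ.symm y k) x := fun x i k => by
    rw [fderiv_coord (hφ'.differentiable (by simp) x)]; rfl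
  refine ⟨changeChart_mem_maximalAtlas hB he.smooth hφ hφ', ?_, ?_⟩
  · obtain ⟨ξ, hξ, hb⟩ := he.dz₁
    refine ⟨ξ, hξ, fun x hx => ?_⟩
    have hx' := ((mem_changeChart_target hB).1 hx).2
    refine chartField_changeChart hB he.smooth hφ' ξ hx'
      (isInvertible_fderiv_homeo_symm hφ hφ' x) ?_
    rw [hb _ hx']
    ext k
    rw [hcol, hφdef, pd_gaugeHomeo_symm hU hV]
    fin_cases k <;> simp [basisVec]
  · obtain ⟨ξ, hξ, hb⟩ := he.dz₂
    -- As `z₂ = μ (w₂ - V)`, the field `∂_{w₂}` is `μ ∂_{z₂}`.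
    refine ⟨μ • ξ, 𝒢.smul_mem μ hξ, fun x hx => ?_⟩
    have hx' := ((mem_changeChart_target hB).1 hx).2
    refine chartField_changeChart hB he.smooth hφ' _ hx'
      (isInvertible_fderiv_homeo_symm hφ hφ' x) ?_
    have hsm : chartField e (μ • ξ) (φ.symm x) = μ • chartField e ξ (φ.symm x) :=
      map_smul (mfderiv (𝓡 4) (𝓡 4) e.symm (φ.symm x)).inverse μ (ξ (e.symm (φ.symm x)))
    rw [hsm, hb _ hx']
    ext k
    rw [hcol, hφdef, pd_gaugeHomeo_symm hU hV]
    fin_cases k <;> simp [basisVec]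

/-- The form `f₁¹ dt₁` is closed because `f₁¹` depends on `t₁` only, so its primitive `U` removes it
entirely, in any rotated coordinates. The form `f₁² dt₁` need not be closed; `V` is chosen to cancel
just its `ds₂` part, as the normal form requires. The set `N` allows the new chart to be confined to
a prescribed neighbourhood. -/
theorem exists_gauge_chart (h : StandingHypotheses g 𝒢 X Λ) (he : IsCaseIIChart g 𝒢 p e) {ε : ℝ}
    (hN : IsNormalForm e.target (chartMetric e g) ε) {α β μ : ℝ} (hD : 0 < α ^ 2 + ε * β ^ 2)
    (hμ : μ ≠ 0) {N : Set (Crd 4)} (hNp : N ∈ nhds (e p)) :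
    ∃ (φ : Crd 4 ≃ₜ Crd 4) (x₀ : Crd 4) (r : ℝ) (e' : OpenPartialHomeomorph M (Crd 4)),
      0 < r ∧ φ (e p) = x₀ ∧ ContDiff ℝ ∞ φ.symm ∧ IsAdaptedChart 𝒢 e' ∧ p ∈ e'.source ∧
      e'.target = cube x₀ r ∧ (∀ x ∈ cube x₀ r, φ.symm x ∈ e.target ∧ φ.symm x ∈ N) ∧
      (∀ x, pd 0 (fun y => φ.symm y 0) x = α ∧ pd 0 (fun y => φ.symm y 1) x = β) ∧
      ∀ x ∈ cube x₀ r, ∃ E > 0, ∃ f, chartMetric e' g x = normalMatrix ε E 0 f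
        (chartMetric e g (φ.symm x) 2 2) (μ * chartMetric e g (φ.symm x) 2 3) := by
  have had := he.adapted
  set G := chartMetric e g with hG
  set c := e p with hc
  have hcT : c ∈ e.target := e.map_source he.mem_source
  obtain ⟨r₀, hr₀, hC⟩ := exists_cube_subset
    (Filter.inter_mem (e.open_target.mem_nhds hcT) hNp)
  have hCT : cube c r₀ ⊆ e.target := fun x hx => (hC hx).1
  have hCo := isOpen_cube c r₀
  have hCc := convex_cube c r₀
  have hcC := mem_cube_self c hr₀
  have hf₁ := h.contDiffOn_fUp_zero had hN
  have hf₂ := h.contDiffOn_fUp_one had hN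
  let ι : Crd 2 → Crd 4 := fun t => !₂[t 0, t 1, c 2, c 3]
  have hι : ContDiff ℝ ∞ ι := by
    rw [contDiff_euclidean]
    intro i
    fin_cases i
    · exact contDiff_coord 0
    · exact contDiff_coord 1
    · exact contDiff_const
    · exact contDiff_const
  have hιC : ∀ x ∈ cube c r₀, ι (tPart x) ∈ cube c r₀ := fun x hx i => by
    fin_cases i
    · exact hx 0
    · exact hx 1
    · simpa [ι] using hr₀
    · simpa [ι] using hr₀
  let κ : ℝ → Crd 4 := fun s => !₂[s, c 1, c 2, c 3]
  have hκ : ContDiff ℝ ∞ κ := by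
    rw [contDiff_euclidean]
    intro i
    fin_cases i
    · exact contDiff_id
    · exact contDiff_const
    · exact contDiff_const
    · exact contDiff_const
  have hκC : ∀ x ∈ cube c r₀, κ (x 0) ∈ cube c r₀ := fun x hx i => by
    fin_cases i
    · exact hx 0
    · simpa [κ] using hr₀
    · simpa [κ] using hr₀
    · simpa [κ] using hr₀
  have hGι : ∀ x ∈ cube c r₀, G x = G (ι (tPart x)) := fun x hx =>
    h.chartMetric_eq had hCc hCT hx (hιC x hx) rfl rfl
  have hF₂ : ∀ x ∈ cube c r₀, fUp G x 0 1 = fUp G (ι (tPart x)) 0 1 := fun x hx => by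
    rw [fUp_congr (hGι x hx)]
  have hF₁ : ∀ x ∈ cube c r₀, fUp G x 0 0 = fUp G (κ (x 0)) 0 0 := fun x hx => by
    rw [fUp_congr (hGι x hx)]
    refine eq_of_pd_eq_zero hCc (F := fun y => fUp G y 0 0)
      (fun z hz => differentiableAt_of_mem e.open_target hf₁ (hCT hz)) (hιC x hx) (hκC x hx)
      fun z hz i hi => ?_
    fin_cases i
    · exact absurd rfl hi
    · exact he.f_dt₂ z (hCT hz)
    · exact absurd rfl hi
    · exact absurd rfl hi
  -- A global function of one variable that equals `f₁¹` near the base point.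
  obtain ⟨F₁, _, hF₁s, -, hF₁e⟩ := exists_contDiff_compactSupport_eventuallyEq
    (f := fun s => fUp G (κ s) 0 0) (isOpen_image_coord hCo 0)
    (hf₁.comp hκ.contDiffOn (by rintro _ ⟨x, hx, rfl⟩; exact hCT (hκC x hx)))
    (⟨c, hcC, rfl⟩ : c 0 ∈ (fun x : Crd 4 => x 0) '' cube c r₀)
  obtain ⟨F, hFs, hF⟩ := exists_contDiff_primitive hF₁s
  -- The old coordinate `t₁` as a function of the new ones, so that `dU = f₁¹ dt₁` near the base
  -- point.
  let ℓ : Crd 2 →L[ℝ] ℝ := α • EuclideanSpace.proj 0 - (ε * β) • EuclideanSpace.proj 1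
  let U : Crd 2 → ℝ := fun t => F (ℓ t)
  have hU : ContDiff ℝ ∞ U := hFs.comp ℓ.contDiff
  have hpdU : ∀ i t, pd i U t = F₁ (ℓ t) * ℓ (basisVec i) := fun i t => by
    have : HasFDerivAt U (F₁ (ℓ t) • ℓ) t := (hF (ℓ t)).comp_hasFDerivAt t ℓ.hasFDerivAt
    rw [pd, this.fderiv]; rfl
  let L : Crd 2 → Crd 2 := fun t => !₂[α * t 0 - ε * β * t 1, β * t 0 + α * t 1]
  have hL : ContDiff ℝ ∞ L := by
    have h0 := contDiff_coord (n := 2) 0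
    have h1 := contDiff_coord (n := 2) 1
    rw [contDiff_euclidean]
    intro i
    fin_cases i
    · exact (contDiff_const.mul h0).sub (contDiff_const.mul h1)
    · exact (contDiff_const.mul h0).add (contDiff_const.mul h1)
  let t₀ : Crd 2 := !₂[(α * c 0 + ε * β * c 1) / (α ^ 2 + ε * β ^ 2),
    (α * c 1 - β * c 0) / (α ^ 2 + ε * β ^ 2)]
  have hLt₀ : L t₀ = tPart c := by
    have h0 : α * ((α * c 0 + ε * β * c 1) / (α ^ 2 + ε * β ^ 2))
        - ε * β * ((α * c 1 - β * c 0) / (α ^ 2 + ε * β ^ 2)) = c 0 := by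
      rw [mul_div_assoc', mul_div_assoc', ← sub_div, div_eq_iff hD.ne']; ring
    have h1 : β * ((α * c 0 + ε * β * c 1) / (α ^ 2 + ε * β ^ 2))
        + α * ((α * c 1 - β * c 0) / (α ^ 2 + ε * β ^ 2)) = c 1 := by
      rw [mul_div_assoc', mul_div_assoc', ← add_div, div_eq_iff hD.ne']; ring
    ext i
    fin_cases i
    · exact h0
    · exact h1
  -- The equation `μ ∂V/∂s₂ = -ε β f₁²` cancels the `ds₂` part of `dz₂ + f₁² dt₁`.
  obtain ⟨V, hV, hVe⟩ := exists_contDiff_pd_one_eq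
    (f := fun s => -(ε * β / μ) * fUp G (ι (L s)) 0 1)
    ((isOpen_image_tPart hCo).preimage hL.continuous)
    (contDiffOn_const.mul (hf₂.comp (hι.comp hL).contDiffOn (by
      rintro s ⟨x, hx, hxs⟩
      change ι (L s) ∈ e.target
      rw [← hxs]; exact hCT (hιC x hx))))
    (show t₀ ∈ L ⁻¹' (tPart '' cube c r₀) from ⟨c, hcC, hLt₀.symm⟩)
  let φ := gaugeHomeo α β ε μ hD.ne' hμ U V hU.continuous hV.continuous
  have hφ' : ContDiff ℝ ∞ φ.symm := contDiff_gaugeHomeo_symm hU hV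
  have hsymm : φ.symm (φ c) = c := φ.symm_apply_apply c
  -- The cut-off data have the required values only near the base point, so the new chart is shrunk
  -- to a cube where they do.
  have hev : ∀ᶠ x in nhds (φ c), φ.symm x ∈ cube c r₀ ∧
      F₁ (φ.symm x 0) = fUp G (κ (φ.symm x 0)) 0 0 ∧
      pd 1 V (tPart x) = -(ε * β / μ) * fUp G (ι (L (tPart x))) 0 1 := by
    refine Filter.Eventually.and ?_ (Filter.Eventually.and ?_ ?_)
    · apply φ.symm.continuous.continuousAt.eventually
      rw [hsymm]
      exact hCo.mem_nhds hcC
    · have hct : ContinuousAt (fun x => φ.symm x 0) (φ c) :=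
        (contDiff_euclidean.1 hφ' 0).continuous.continuousAt
      have hs : F₁ =ᶠ[nhds (φ.symm (φ c) 0)] fun s => fUp G (κ s) 0 0 := by
        rw [hsymm]; exact hF₁e
      exact hct.eventually hs
    · have hs : ∀ᶠ s in nhds (tPart (φ c)), pd 1 V s = -(ε * β / μ) * fUp G (ι (L s)) 0 1 := hVe
      exact contDiff_tPart.continuous.continuousAt.eventually hs
  obtain ⟨r, hr, hB⟩ := exists_cube_subset hev
  have hBo := isOpen_cube (φ c) r
  refine ⟨φ, φ c, r, changeChart e φ (cube (φ c) r) hBo, hr, rfl, hφ',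
    isAdaptedChart_changeChart had hU hV hBo,
    (mem_changeChart_source hBo).2 ⟨he.mem_source, mem_cube_self _ hr⟩, ?_,
    fun x hx => ⟨hCT (hB hx).1, (hC (hB hx).1).2⟩, fun x => ?_, fun x hx => ?_⟩
  · ext x
    rw [mem_changeChart_target]
    exact ⟨fun hx => hx.1, fun hx => ⟨hx, hCT (hB hx).1⟩⟩
  · constructor <;> rw [pd_gaugeHomeo_symm hU hV] <;> simp
  · obtain ⟨hyC, hy₁, hy₂⟩ := hB hx
    have hyT := hCT hyC
    obtain ⟨E, hE, hGy⟩ := h.eq_normalMatrix had hN hyT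
    have hy0 : φ.symm x 0 = ℓ (tPart x) := by simp [ℓ, φ, gaugeHomeo_symm_apply]
    have hyt : tPart (φ.symm x) = L (tPart x) := rfl
    have e1 : F₁ (ℓ (tPart x)) = fUp G (φ.symm x) 0 0 := by
      rw [hF₁ _ hyC, ← hy₁, hy0]
    have e2 : pd 1 V (tPart x) = -(ε * β / μ) * fUp G (φ.symm x) 0 1 := by
      rw [hF₂ _ hyC, hyt, hy₂]
    refine ⟨(α ^ 2 + ε * β ^ 2) * E, mul_pos hD hE,
      (α * fUp G (φ.symm x) 0 1 - μ * pd 0 V (tPart x)) / μ, ?_⟩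
    ext i j
    rw [chartMetric_changeChart hBo had.smooth hφ' g hyT]
    simp only [φ, pd_gaugeHomeo_symm hU hV]
    rw [← normalMatrix_transform (α := α) (β := β) (μ := μ) (f₁ := fUp G (φ.symm x) 0 0)
      (f₂ := fUp G (φ.symm x) 0 1) (u₀ := pd 0 U (tPart x)) (u₁ := pd 1 U (tPart x))
      (v₀ := pd 0 V (tPart x)) (v₁ := pd 1 V (tPart x)), ← hGy]
    · rw [hpdU, e1]; simp [ℓ, basisVec, mul_comm]
    · rw [hpdU, e1]; simp [ℓ, basisVec]; ring
    · field_simp; ring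
    · rw [e2]; field_simp

end Charts

/-! ### Constancy of `h₁₂` and the model chart -/

section Main

variable {M : Type*} [TopologicalSpace M] [ChartedSpace (Crd 4) M] [IsManifold (𝓡 4) ∞ M]
  {g : ∀ p : M, LinearMap.BilinForm ℝ (TangentSpace (𝓡 4) p)}
  {𝒢 : Submodule ℝ (∀ p : M, TangentSpace (𝓡 4) p)}
  {X : ∀ p : M, TangentSpace (𝓡 4) p} {Λ : ℝ} {p : M} {e : OpenPartialHomeomorph M (Crd 4)}

theorem isNormalForm_of_normalMatrix {W : Set (Crd 4)} {G : Crd 4 → Matrix (Fin 4) (Fin 4) ℝ}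
    {ε : ℝ} (hε : ε = 1 ∨ ε = -1)
    (hG : ∀ x ∈ W, ∃ E > 0, ∃ f₁ f₂ a h, h ≠ 0 ∧ G x = normalMatrix ε E f₁ f₂ a h) :
    IsNormalForm W G ε := by
  refine ⟨hε, fun x hx => ?_, ⟨fun x => -(1 / 2) * Real.log (orbitMetric G x 0 0), fun x hx => ?_⟩,
    fun x hx => ?_⟩ <;> obtain ⟨E, hE, f₁, f₂, a, h, hh, e⟩ := hG x hx
  · rw [e]; simp [normalMatrix]
  · have ho := orbitMetric_of_normalMatrix e hh
    have h2 : -2 * (-(1 / 2) * Real.log E) = Real.log E := by ring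
    simp only [ho, Matrix.of_apply, Matrix.cons_val_zero, Matrix.cons_val', h2, Real.exp_log hE]
  · rw [fUp_of_normalMatrix e hh]; simp

/-- The hypothesis is used in two charts. In the rotated or boosted one `∂_{s₁}` acts on `h₁₂` as `α
∂_{t₁} + β ∂_{t₂}`; since `∂_{t₁}h₁₂ = 0` in the original chart and `β ≠ 0`, also `∂_{t₂}h₁₂ = 0`.
-/
theorem exists_pd_one_eq_zero (h : StandingHypotheses g 𝒢 X Λ) (hII : CaseII3 g 𝒢 p)
    (he : IsCaseIIChart g 𝒢 p e) {ε : ℝ} (hN : IsNormalForm e.target (chartMetric e g) ε) :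
    ∀ᶠ y in nhds (e p), y ∈ e.target ∧ pd 1 (fun y => chartMetric e g y 2 3) y = 0 := by
  -- The choice `(α, β) = (2, 1)` has `β ≠ 0` and keeps the conformal factor `α² + ε β²` positive
  -- for both signs; `(1, 1)` would degenerate for `ε = -1`.
  have hD : 0 < (2 : ℝ) ^ 2 + ε * 1 ^ 2 := by rcases hN.sign with rfl | rfl <;> norm_num
  obtain ⟨φ, x₀, r, e', hr, hx₀, hφ', had, hp, htar, hmem, hpd, hG⟩ :=
    exists_gauge_chart h he hN hD one_ne_zero Filter.univ_mem
  have hne : ∀ x ∈ cube x₀ r, (1 : ℝ) * chartMetric e g (φ.symm x) 2 3 ≠ 0 := fun x hx =>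
    mul_ne_zero one_ne_zero (h.chartMetric_two_three_ne he.adapted hN (hmem x hx).1)
  have hfUp : ∀ x ∈ e'.target, fUp (chartMetric e' g) x 0 0 = 0 := fun x hx => by
    rw [htar] at hx
    obtain ⟨E, -, f, hE⟩ := hG x hx
    rw [fUp_of_normalMatrix hE (hne x hx)]; simp
  have he' : IsCaseIIChart g 𝒢 p e' := by
    refine ⟨had, hp, ⟨ε, isNormalForm_of_normalMatrix hN.sign fun x hx => ?_⟩,
      fun x hx => pd_zero_of_eqOn e'.open_target hx hfUp⟩
    rw [htar] at hx
    obtain ⟨E, hE, f, hE'⟩ := hG x hx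
    exact ⟨E, hE, _, _, _, _, hne x hx, hE'⟩
  have hzero : ∀ x ∈ cube x₀ r, pd 1 (fun y => chartMetric e g y 2 3) (φ.symm x) = 0 := by
    intro x hx
    have hy := (hmem x hx).1
    have h0 := hII.h_dt₁ e' he' x (by rw [htar]; exact hx)
    have h0' : pd 0 (fun y => chartMetric e g y 2 3) (φ.symm x) = 0 :=
      hII.h_dt₁ e he (φ.symm x) hy
    rw [pd_congr_of_eqOn (H := fun y => chartMetric e g (φ.symm y) 2 3) (isOpen_cube x₀ r) hx
      fun y hy => by
        obtain ⟨E, -, f, hE⟩ := hG y hy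
        simp [hMat, hE, normalMatrix],
      pd_comp (F := fun y => chartMetric e g y 2 3) (Φ := φ.symm)
        (differentiableAt_of_mem e.open_target (h.metric_smooth e he.adapted.smooth 2 3) hy)
        (hφ'.differentiable (by simp) x),
      Fin.sum_univ_four, (hpd x).1, (hpd x).2, h0',
      h.pd_chartMetric he.adapted hy (Or.inl rfl), h.pd_chartMetric he.adapted hy (Or.inr rfl)] at h0
    linarith
  have hopen : φ ⁻¹' cube x₀ r ∈ nhds (e p) :=
    ((isOpen_cube x₀ r).preimage φ.continuous).mem_nhds (by
      change φ (e p) ∈ cube x₀ r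
      rw [hx₀]; exact mem_cube_self x₀ hr)
  filter_upwards [hopen] with y hy
  have h1 := hmem _ hy
  have h2 := hzero _ hy
  rw [φ.symm_apply_apply] at h1 h2
  exact ⟨h1.1, h2⟩

/-- On a cube where `h₁₂` is constant, a second change of gauge without rotation and with `μ = 1 /
h₁₂` achieves `f₁¹ = 0` and `h₁₂ = 1` together. -/
theorem exists_chart_modelMetric (h : StandingHypotheses g 𝒢 X Λ) (hII : CaseII3 g 𝒢 p) :
    ∃ (e : OpenPartialHomeomorph M (Crd 4)) (ε : ℝ) (x₀ : Crd 4) (r : ℝ) (P ψ f : Crd 2 → ℝ),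
      IsAdaptedChart 𝒢 e ∧ p ∈ e.source ∧ 0 < r ∧ e.target = cube x₀ r ∧
      SmoothCoeff (cube x₀ r) ε P ψ f ∧
      ∀ x ∈ cube x₀ r, chartMetric e g x = modelMetric ε 1 P ψ f x := by
  obtain ⟨e, he⟩ := hII.exists_chart
  obtain ⟨ε, hN⟩ := he.normal_form
  obtain ⟨r₁, hr₁, hC⟩ := exists_cube_subset (exists_pd_one_eq_zero h hII he hN)
  set c := e p with hc
  have hcT : c ∈ e.target := e.map_source he.mem_source
  set H : Crd 4 → ℝ := fun y => chartMetric e g y 2 3 with hH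
  have hHd : ∀ z ∈ e.target, DifferentiableAt ℝ H z := fun z hz =>
    differentiableAt_of_mem e.open_target (h.metric_smooth e he.adapted.smooth 2 3) hz
  have hHc : ∀ y ∈ cube c r₁, H y = H c := fun y hy => by
    refine eq_of_pd_eq_zero (convex_cube c r₁) (fun z hz => hHd z (hC hz).1) hy
      (mem_cube_self c hr₁) fun z hz i _ => ?_
    fin_cases i
    · exact hII.h_dt₁ e he z (hC hz).1
    · exact (hC hz).2
    · exact h.pd_chartMetric he.adapted (hC hz).1 (Or.inl rfl) 2 3
    · exact h.pd_chartMetric he.adapted (hC hz).1 (Or.inr rfl) 2 3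
  have hH0 : H c ≠ 0 := h.chartMetric_two_three_ne he.adapted hN hcT
  have hD : 0 < (1 : ℝ) ^ 2 + ε * 0 ^ 2 := by norm_num
  obtain ⟨φ, x₀, r, e', hr, -, -, had, hp, htar, hmem, -, hG⟩ :=
    exists_gauge_chart h he hN hD (inv_ne_zero hH0)
      ((isOpen_cube c r₁).mem_nhds (mem_cube_self c hr₁))
  have hG' : ∀ x ∈ cube x₀ r, ∃ E > 0, ∃ f a, chartMetric e' g x = normalMatrix ε E 0 f a 1 :=
    fun x hx => by
      obtain ⟨E, hE, f, hE'⟩ := hG x hx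
      refine ⟨E, hE, f, chartMetric e g (φ.symm x) 2 2, ?_⟩
      rw [hE', show chartMetric e g (φ.symm x) 2 3 = H c from hHc _ (hmem x hx).2, inv_mul_cancel₀ hH0]
  let ι : Crd 2 → Crd 4 := fun t => !₂[t 0, t 1, x₀ 2, x₀ 3]
  have hι : ContDiff ℝ ∞ ι := by
    rw [contDiff_euclidean]
    intro i
    fin_cases i
    · exact contDiff_coord 0
    · exact contDiff_coord 1
    · exact contDiff_const
    · exact contDiff_const
  have hιC : ∀ x ∈ cube x₀ r, ι (tPart x) ∈ cube x₀ r := fun x hx i => by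
    fin_cases i
    · exact hx 0
    · exact hx 1
    · simpa [ι] using hr
    · simpa [ι] using hr
  have hιG : ∀ x ∈ cube x₀ r, chartMetric e' g x = chartMetric e' g (ι (tPart x)) := fun x hx =>
    h.chartMetric_eq had (convex_cube x₀ r) htar.symm.le hx (hιC x hx) rfl rfl
  have hsm : ∀ i j, ContDiffOn ℝ ∞ (fun t => chartMetric e' g (ι t) i j)
      (tPart '' cube x₀ r) := fun i j =>
    (h.metric_smooth e' had.smooth i j).comp hι.contDiffOn (by
      rintro _ ⟨x, hx, rfl⟩
      change ι (tPart x) ∈ e'.target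
      rw [htar]; exact hιC x hx)
  have hpos : ∀ x ∈ cube x₀ r, 0 < chartMetric e' g x 0 0 := fun x hx => by
    obtain ⟨E, hE, f, a, hE'⟩ := hG' x hx
    rw [hE']; simpa [normalMatrix] using hE
  -- When `f₁¹ = 0` and `h₁₂ = 1`, the components `(t₁, t₁)`, `(z₁, z₁)` and `(t₁, z₁)` are
  -- `e^{-2P}`, `ψ` and `f₁²`; they are evaluated on the slice of constant `z₁, z₂` through the
  -- centre to become functions of `(t₁, t₂)`.
  refine ⟨e', ε, x₀, r, fun t => -(1 / 2) * Real.log (chartMetric e' g (ι t) 0 0),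
    fun t => chartMetric e' g (ι t) 2 2, fun t => chartMetric e' g (ι t) 0 2, had, hp, hr, htar,
    ⟨isOpen_cube x₀ r, hN.sign, contDiffOn_const.mul ((hsm 0 0).log ?_), hsm 2 2, hsm 0 2⟩,
    fun x hx => ?_⟩
  · rintro _ ⟨x, hx, rfl⟩
    exact (hpos _ (hιC x hx)).ne'
  · have h2 : ∀ s : ℝ, -2 * (-(1 / 2) * s) = s := fun s => by ring
    simp only [modelMetric, h2, ← hιG x hx, Real.exp_log (hpos x hx)]
    obtain ⟨E, hE, f, a, hE'⟩ := hG' x hx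
    rw [hE']
    ext i j
    fin_cases i <;> fin_cases j <;> simp [normalMatrix]

theorem exists_model_chart (h : StandingHypotheses g 𝒢 X Λ) (hII : CaseII3 g 𝒢 p) :
    ∃ (e : OpenPartialHomeomorph M (Crd 4)) (ε a c : ℝ) (P ψ Q : Crd 2 → ℝ) (A : ℝ → ℝ),
      IsAdaptedChart 𝒢 e ∧ p ∈ e.source ∧ IsModelData e.target Λ ε c P ψ Q A ∧
      (∀ x ∈ e.target, chartMetric e g x = modelMetric ε c P ψ Q x) ∧
      ∀ x ∈ e.target, chartField e X x = modelField Λ a A x := by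
  obtain ⟨e, ε, x₀, r, P, ψ, f, had, hp, hr, htar, hs, hG⟩ := exists_chart_modelMetric h hII
  have hsol := h.soliton e had.smooth
  have hac := h.adapted e had
  have hX := contDiffOn_chartField had.smooth h.field_smooth
  rw [htar] at hsol hac hX
  obtain ⟨a, c, A, hdata, hV⟩ := exists_modelData_of_soliton hr hs hX
    (hsol.congr hs.isOpen hG) (hac.congr hs.isOpen hG)
  refine ⟨e, ε, a, c, P, ψ, fun t => c⁻¹ * f t, A, had, hp, ?_, ?_, ?_⟩ <;> rw [htar]
  · exact hdata
  · exact fun x hx => (hG x hx).trans (modelMetric_rescale hdata.c_ne x).symm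
  · exact hV

theorem IsModelData.gaussCurvature_eq {W : Set (Crd 4)} {ε c : ℝ} {P ψ Q : Crd 2 → ℝ}
    {A : ℝ → ℝ} (hd : IsModelData W Λ ε c P ψ Q A) (hW : IsOpen W) {t : Crd 2}
    (ht : t ∈ tPart '' W) : gaussCurvature (modelOrbitMetric ε P) t = Λ := by
  rw [gaussCurvature_modelOrbitMetric hd.sign (isOpen_image_tPart hW) hd.P_smooth ht,
    hd.liouville t ht, mul_assoc, neg_mul, exp_neg_mul_exp, mul_one]

end Main

end RicciSoliton

end

theorem mainTheorem3 :
    -- every soliton of Case II-3 is locally a model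
    (∀ (M : Type*) [TopologicalSpace M] [ChartedSpace (RicciSoliton.Crd 4) M]
        [IsManifold (𝓡 4) ∞ M]
        (g : ∀ p : M, LinearMap.BilinForm ℝ (TangentSpace (𝓡 4) p))
        (𝒢 : Submodule ℝ (∀ p : M, TangentSpace (𝓡 4) p))
        (X : ∀ p : M, TangentSpace (𝓡 4) p) (Λ : ℝ) (p : M),
      RicciSoliton.StandingHypotheses g 𝒢 X Λ → RicciSoliton.CaseII3 g 𝒢 p →
        ∃ (e : OpenPartialHomeomorph M (RicciSoliton.Crd 4)) (ε a c : ℝ)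
          (P ψ Q : RicciSoliton.Crd 2 → ℝ) (A : ℝ → ℝ),
          RicciSoliton.IsAdaptedChart 𝒢 e ∧ p ∈ e.source ∧
          RicciSoliton.IsModelData e.target Λ ε c P ψ Q A ∧
          (∀ x ∈ e.target,
            RicciSoliton.chartMetric e g x = RicciSoliton.modelMetric ε c P ψ Q x) ∧
          (∀ x ∈ e.target,
            RicciSoliton.chartField e X x = RicciSoliton.modelField Λ a A x) ∧
          (∀ x ∈ e.target,
            RicciSoliton.orbitMetric (RicciSoliton.chartMetric e g) x
              = RicciSoliton.modelOrbitMetric ε P (RicciSoliton.tPart x)) ∧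
          (∀ t ∈ RicciSoliton.tPart '' e.target,
            RicciSoliton.gaussCurvature (RicciSoliton.modelOrbitMetric ε P) t = Λ)) ∧
    -- every model is such a soliton, in the given adapted coordinates
    (∀ (W : Set (RicciSoliton.Crd 4)), IsOpen W →
      ∀ (Λ ε a c : ℝ) (P ψ Q : RicciSoliton.Crd 2 → ℝ) (A : ℝ → ℝ),
        RicciSoliton.IsModelData W Λ ε c P ψ Q A →
        (∀ i j, ContDiffOn ℝ ∞ (fun x => RicciSoliton.modelMetric ε c P ψ Q x i j) W) ∧
        ContDiffOn ℝ ∞ (RicciSoliton.modelField Λ a A) W ∧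
        (∀ x ∈ W, (RicciSoliton.modelMetric ε c P ψ Q x).IsSymm) ∧
        (∀ x ∈ W, (RicciSoliton.modelMetric ε c P ψ Q x).det ≠ 0) ∧
        RicciSoliton.SolitonEquationOn W (RicciSoliton.modelMetric ε c P ψ Q)
          (RicciSoliton.modelField Λ a A) Λ ∧
        RicciSoliton.IsKillingOn W (RicciSoliton.modelMetric ε c P ψ Q)
          (fun _ => RicciSoliton.basisVec 2) ∧
        RicciSoliton.IsKillingOn W (RicciSoliton.modelMetric ε c P ψ Q)
          (fun _ => RicciSoliton.basisVec 3) ∧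
        RicciSoliton.AdaptedConditions W (RicciSoliton.modelMetric ε c P ψ Q)
          (RicciSoliton.modelField Λ a A) ∧
        RicciSoliton.IsNormalForm W (RicciSoliton.modelMetric ε c P ψ Q) ε ∧
        (∀ x ∈ W,
          RicciSoliton.pd 1
              (fun y => RicciSoliton.fUp (RicciSoliton.modelMetric ε c P ψ Q) y 0 0) x = 0 ∧
          ∀ i, RicciSoliton.pd i
              (fun y => RicciSoliton.hMat (RicciSoliton.modelMetric ε c P ψ Q) y 0 1) x = 0)) ∧
    -- every value of `Λ` occurs: expanding, steady and shrinking solitons exist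
    (∀ Λ ε : ℝ, (ε = 1 ∨ ε = -1) →
      ∃ (W : Set (RicciSoliton.Crd 4)) (c : ℝ) (P ψ Q : RicciSoliton.Crd 2 → ℝ) (A : ℝ → ℝ),
        IsOpen W ∧ W.Nonempty ∧ RicciSoliton.IsModelData W Λ ε c P ψ Q A) := by
  refine ⟨?_, ?_, ?_⟩
  · intro M _ _ _ g 𝒢 X Λ p h hII
    obtain ⟨e, ε, a, c, P, ψ, Q, A, had, hp, hd, hG, hV⟩ := RicciSoliton.exists_model_chart h hII
    refine ⟨e, ε, a, c, P, ψ, Q, A, had, hp, hd, hG, hV, fun x hx => ?_, fun t ht =>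
      hd.gaussCurvature_eq e.open_target ht⟩
    rw [RicciSoliton.orbitMetric_congr (hG x hx), RicciSoliton.orbitMetric_modelMetric]
  · intro W hW Λ ε a c P ψ Q A hd
    refine ⟨(hd.smoothCoeff hW).contDiffOn_modelMetric, RicciSoliton.contDiffOn_modelField
      hd.A_smooth, fun x _ => RicciSoliton.modelMetric_isSymm x,
      fun x _ => RicciSoliton.modelMetric_det_ne hd.sign x, hd.solitonEquationOn hW,
      RicciSoliton.isKillingOn_modelMetric (Or.inl rfl),
      RicciSoliton.isKillingOn_modelMetric (Or.inr rfl), hd.adaptedConditions hW,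
      RicciSoliton.isNormalForm_modelMetric hd.sign, fun x _ => ⟨?_, fun i => ?_⟩⟩
    · simp [RicciSoliton.fUp_modelMetric, RicciSoliton.pd_const]
    · simp [RicciSoliton.hMat_modelMetric, RicciSoliton.pd_const]
  · exact RicciSoliton.exists_modelData
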